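/- Let $-\infty<a<b<\infty$, let $d\ge 1$ be an integer, $\varrho\in(\frac12,1]$, $K,L\in(0,\infty)$ and $p\in[2,\infty)$. Let $\|\cdot\|$ be the one norm on $\mathbb R^d$ and $B(x,r)$ the closed ball ($B(x,\infty)=\mathbb R^d$). For $R\in[0,\infty]$ let $F^\varrho_R$ be the class of pairs $(\eta,f)$ with $\eta\in\mathbb R^d$, $\|\eta\|\le K$, and $f:[a,b]\times\mathbb R^d\to\mathbb R^d$ continuous such that $\|f(t,x)\|\le K(1+\|x\|)$ for all $t\in[a,b]$, $x\in\mathbb R^d$, and $\|f(t,x)-f(s,x)\|\le L|t-s|^\varrho$, $\|f(t,x)-f(t,y)\|\le L\|x-y\|$ for all $s,t\in[a,b]$, $x,y\in B(\eta,R)$. Put $R_0=\max\{R_1,R_2\}$ with $R_1=(K+2)e^{(K+1)(b-a)}+K-1$ and $R_2=K(1+b-a)e^{K(b-a)}+K$. For $(\eta,f)\in F^\varrho_{R_0}$ (in particular, for $(\eta,f)\in F^\varrho_\infty$) let $z(\eta,f)$ be the unique solution on $[a,b]$ of $z'(t)=f(t,z(t))$, $z(a)=\eta$. For $\delta\in[0,1]$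 let $\mathcal K_1(\delta)$ be the set of Borel measurable $g:[a,b]\times\mathbb R^d\to\mathbb R^d$ with $\|g(t,y)\|\le\delta(1+\|y\|)$, and $\mathcal K_2(\delta)$ the set of those $g\in\mathcal K_1(\delta)$ with $\|g(t,x)-g(t,y)\|\le\delta\|x-y\|$, for all $t\in[a,b]$, $x,y\in\mathbb R^d$. For $i\in\{1,2\}$ let $V^i_{(\eta,f)}(\delta)=\{(\tilde\eta,f+g):\ \|\tilde\eta-\eta\|\le\delta,\ g\in\mathcal K_i(\delta)\}$. For $n\ge1$ let $h=\frac{b-a}n$, $t_j=a+jh$, $\theta_j=t_{j-1}+\tau_jh$, where $\tau_1,\dots,\tau_n$ are independent random variables, uniformly distributed on $(0,1)$, on a probability space $(\Omega,\Sigma,\mathbb P)$. For inexact data $(\tilde\eta,\tilde f)$ the randomized explicit and implicit Euler values are $$V^0=\tilde\eta,\quad V^j=V^{j-1}+h\tilde f(\theta_j,V^{j-1});\qquad U^0=\tilde\eta,\quad U^j=U^{j-1}+h\tilde f(\theta_j,U^j)\qquad(1\le j\le n)$$ (for $(\tilde\eta,\tilde f)\in V^2_{(\eta,f)}(\delta)$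 with $(\eta,f)\in F^\varrho_\infty$ and all $n$ with $h(L+1)<1$, the $U^j$ exist and are unique almost surely), and $l^{EE}$, $l^{IE}$ denote the continuous functions on $[a,b]$ that are affine on each $[t_{j-1},t_j]$ and take the values $V^j$, respectively $U^j$, at $t_j$ ($0\le j\le n$). For $l\in\{l^{EE},l^{IE}\}$, a class $\mathcal G$ of pairs and $i\in\{1,2\}$, the worst-case error is $$e^{(p)}(l,\mathcal G,V^i,\delta)=\sup_{(\eta,f)\in\mathcal G}\ \sup_{(\tilde\eta,\tilde f)\in V^i_{(\eta,f)}(\delta)}\Bigl(\mathbb E\sup_{a\le t\le b}\bigl\|z(\eta,f)(t)-l(\tilde\eta,\tilde f)(t)\bigr\|^p\Bigr)^{1/p}.$$ Then $$e^{(p)}(l^{EE},F^\varrho_{R_0},V^1,\delta)=\Theta(n^{-1}+\delta),\qquad e^{(p)}(l^{IE},F^\varrho_\infty,V^2,\delta)=\Theta(n^{-1}+\delta)$$ as $n\to\infty$ and $\delta\to0^+$. That is, there are $c,C>0$, $n_0\ge1$ and $\delta_0\in(0,1]$, depending only on $a,b,d,\varrho,K,L,p$ (and not on the probability space or the $\tau_j$),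 such that both errors lie between $c(n^{-1}+\delta)$ and $C(n^{-1}+\delta)$ for all $n\ge n_0$ and all $\delta\in[0,\delta_0]$. Consequently neither error is $O(n^{-(\varrho+1/2)}+\delta)$. Even for exact information ($\delta=0$), for every $M$ both errors exceed $Mn^{-(\varrho+1/2)}$ for all sufficiently large $n$ (again uniformly over the probability space and the $\tau_j$). -/

import Mathlib

open MeasureTheory ProbabilityTheory Set
open scoped ENNReal

noncomputable section

namespace RandEuler

/-- `ℝ^d` with the one norm `‖x‖ = ∑ k, |x k|` (and its Borel σ-field). -/
abbrev Vec (d : ℕ) : Type := PiLp 1 (fun _ : Fin d => ℝ)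

/-- A right-hand side (or a noise function) on `[a,b] × ℝ^d`. It is represented by a function
of all real times; every condition below only concerns its values at times in `[a,b]`. -/
abbrev Field (d : ℕ) : Type := ℝ → Vec d → Vec d

/-- The class `F^ρ_R(a,b,d,ρ,K,L)` of initial value problems `(η, f)`, for `R ∈ [0,∞]`.
The closed ball `B(η,R)` is `{x | ‖x - η‖ₑ ≤ R}`, which is `ℝ^d` for `R = ∞`. -/
structure IsIVP (a b : ℝ) {d : ℕ} (ρ K L : ℝ) (R : ℝ≥0∞) (η : Vec d) (f : Field d) :
    Prop where
  init_bound : ‖η‖ ≤ K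
  cont : ContinuousOn (fun q : ℝ × Vec d => f q.1 q.2) (Icc a b ×ˢ univ)
  growth : ∀ t ∈ Icc a b, ∀ x, ‖f t x‖ ≤ K * (1 + ‖x‖)
  holder_time : ∀ t ∈ Icc a b, ∀ s ∈ Icc a b, ∀ x, ‖x - η‖ₑ ≤ R →
    ‖f t x - f s x‖ ≤ L * |t - s| ^ ρ
  lipschitz_space : ∀ t ∈ Icc a b, ∀ x y, ‖x - η‖ₑ ≤ R → ‖y - η‖ₑ ≤ R →
    ‖f t x - f t y‖ ≤ L * ‖x - y‖

/-- The class `F^ρ_R` as a set of pairs `(η, f)`. -/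
def ivpClass (a b : ℝ) (d : ℕ) (ρ K L : ℝ) (R : ℝ≥0∞) : Set (Vec d × Field d) :=
  {q | IsIVP a b ρ K L R q.1 q.2}

/-- The radius `R₁ = (K+2) e^{(K+1)(b-a)} + K - 1`. -/
def radiusOne (a b K : ℝ) : ℝ := (K + 2) * Real.exp ((K + 1) * (b - a)) + K - 1

/-- The radius `R₂ = K (1+b-a) e^{K(b-a)} + K`. -/
def radiusTwo (a b K : ℝ) : ℝ := K * (1 + b - a) * Real.exp (K * (b - a)) + K

/-- The radius `R₀ = max {R₁, R₂}`. -/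
def radiusZero (a b K : ℝ) : ℝ := max (radiusOne a b K) (radiusTwo a b K)

/-- The noise class `𝒦₁(δ)`: Borel measurable on `[a,b] × ℝ^d`, of linear growth. -/
def noiseOne (a b : ℝ) (d : ℕ) (δ : ℝ) : Set (Field d) :=
  {g | Measurable ((Icc a b ×ˢ (univ : Set (Vec d))).domRestrict
        (fun q : ℝ × Vec d => g q.1 q.2)) ∧
      ∀ t ∈ Icc a b, ∀ y, ‖g t y‖ ≤ δ * (1 + ‖y‖)}

/-- The noise class `𝒦₂(δ)`: members of `𝒦₁(δ)` that are `δ`-Lipschitz in space. -/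
def noiseTwo (a b : ℝ) (d : ℕ) (δ : ℝ) : Set (Field d) :=
  {g | g ∈ noiseOne a b d δ ∧
      ∀ t ∈ Icc a b, ∀ x y, ‖g t x - g t y‖ ≤ δ * ‖x - y‖}

/-- The inexact data `B(η,δ) × {f + g | g ∈ 𝒦}` about the problem `q = (η, f)`. With
`𝒦 = 𝒦ᵢ(δ)` this is `V^i_{(η,f)}(δ)`. -/
def noisyData {d : ℕ} (𝒦 : Set (Field d)) (δ : ℝ) (q : Vec d × Field d) :
    Set (Vec d × Field d) :=
  {q' | ‖q'.1 - q.1‖ ≤ δ ∧ ∃ g ∈ 𝒦, q'.2 = fun t y => q.2 t y + g t y}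

/-- `z` solves `z' = f(t, z)` on `[a,b]`, `z(a) = η` (one-sided derivatives at the ends). -/
def IsSolution (a b : ℝ) {d : ℕ} (q : Vec d × Field d) (z : ℝ → Vec d) : Prop :=
  z a = q.1 ∧ ∀ t ∈ Icc a b, HasDerivWithinAt z (q.2 t (z t)) (Icc a b) t

/-- The solution `z(η,f)`. For the classes `F^ρ_R` with `R ≥ R₂` a solution exists
and is unique on `[a,b]`, so that the choice made here is immaterial. -/
def solution (a b : ℝ) {d : ℕ} (q : Vec d × Field d) : ℝ → Vec d :=
  Classical.epsilon (IsSolution a b q)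

/-- The randomized nodes `θ_j = t_{j-1} + τ_j h`, with `h = (b-a)/n`, `t_j = a + j h`
(used for `1 ≤ j ≤ n`). -/
def node (a b : ℝ) (n : ℕ) (τ : ℕ → ℝ) (j : ℕ) : ℝ :=
  a + ((j : ℝ) - 1) * ((b - a) / n) + τ j * ((b - a) / n)

/-- Explicit Euler values: `V^0 = η`, `V^j = V^{j-1} + h f(θ_j, V^{j-1})`. -/
def explicitValues {d : ℕ} (h : ℝ) (θ : ℕ → ℝ) (q : Vec d × Field d) : ℕ → Vec d
  | 0 => q.1
  | j + 1 => explicitValues h θ q j + h • q.2 (θ (j + 1)) (explicitValues h θ q j)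

/-- Implicit Euler values: `U^0 = η`, and `U^j` is the solution `x` of
`x = U^{j-1} + h f(θ_j, x)`; it is unique as soon as `x ↦ h f(θ_j, x)` is a contraction. -/
def implicitValues {d : ℕ} (h : ℝ) (θ : ℕ → ℝ) (q : Vec d × Field d) : ℕ → Vec d
  | 0 => q.1
  | j + 1 => Classical.epsilon fun x : Vec d =>
      x = implicitValues h θ q j + h • q.2 (θ (j + 1)) x

/-- The piecewise linear function on `[a,b]` that takes the values `w 0, …, w n` at the
equidistant points `t_j = a + j h`, `h = (b-a)/n`, for `n ≥ 1`: with
`k = min ⌊(t-a)/h⌋ (n-1)`, so that `t ∈ [t_k, t_{k+1}]`, its value at `t` is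
`w k + ((t - t_k)/h) (w (k+1) - w k)`. -/
def interpolate (a b : ℝ) {d : ℕ} (n : ℕ) (w : ℕ → Vec d) (t : ℝ) : Vec d :=
  w (min ⌊(t - a) / ((b - a) / n)⌋₊ (n - 1)) +
    ((t - (a + (min ⌊(t - a) / ((b - a) / n)⌋₊ (n - 1) : ℕ) * ((b - a) / n))) /
        ((b - a) / n)) •
      (w (min ⌊(t - a) / ((b - a) / n)⌋₊ (n - 1) + 1) -
        w (min ⌊(t - a) / ((b - a) / n)⌋₊ (n - 1)))

/-- The output `l^{EE}` of the randomized explicit Euler scheme with `n` steps, for the sample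
`τ = (τ_1, …, τ_n)` and the (noisy) data `q`. -/
def explicitEuler (a b : ℝ) {d : ℕ} (n : ℕ) (τ : ℕ → ℝ) (q : Vec d × Field d) : ℝ → Vec d :=
  interpolate a b n (explicitValues ((b - a) / n) (node a b n τ) q)

/-- The output `l^{IE}` of the randomized implicit Euler scheme with `n` steps, for the sample
`τ = (τ_1, …, τ_n)` and the (noisy) data `q`. -/
def implicitEuler (a b : ℝ) {d : ℕ} (n : ℕ) (τ : ℕ → ℝ) (q : Vec d × Field d) : ℝ → Vec d :=
  interpolate a b n (implicitValues ((b - a) / n) (node a b n τ) q)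

/-- `τ_1, …, τ_n` are independent random variables with the uniform distribution on `(0,1)`.
Nothing is assumed about `τ j` for the other `j`, which the schemes do not use. -/
structure IsUniformSample {Ω : Type*} [MeasurableSpace Ω] (P : Measure Ω) (n : ℕ)
    (τ : ℕ → Ω → ℝ) : Prop where
  meas : ∀ j ∈ Icc 1 n, Measurable (τ j)
  unif : ∀ j ∈ Icc 1 n, pdf.IsUniform (τ j) (Ioo (0 : ℝ) 1) P volume
  indep : iIndepFun (fun j : Icc 1 n => τ j) P

/-- The worst-case `L^p(Ω)`-error
`sup_{q ∈ G} sup_{q' ∈ V q} ‖ sup_{a ≤ t ≤ b} ‖z(q)(t) - A(q')(t)‖ ‖_p`, with values in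
`[0,∞]`, of the randomized algorithm `ω ↦ A ω q'` over the class `G` of problems, where
`V q` is the set of admissible inexact data about `q`. -/
def worstCaseError {Ω : Type*} [MeasurableSpace Ω] (P : Measure Ω) (p a b : ℝ) {d : ℕ}
    (A : Ω → Vec d × Field d → ℝ → Vec d) (G : Set (Vec d × Field d))
    (V : Vec d × Field d → Set (Vec d × Field d)) : ℝ≥0∞ :=
  ⨆ q ∈ G, ⨆ q' ∈ V q,
    eLpNorm (fun ω => ⨆ t ∈ Icc a b, ‖solution a b q t - A ω q' t‖ₑ) (ENNReal.ofReal p) P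

/-- `e^{(p)}(l^{EE}, F^ρ_{R₀}, V^1, δ)` for the scheme with `n` steps and sample `τ`. -/
def errorExplicit {Ω : Type*} [MeasurableSpace Ω] (P : Measure Ω) (τ : ℕ → Ω → ℝ)
    (p a b : ℝ) (d : ℕ) (ρ K L : ℝ) (n : ℕ) (δ : ℝ) : ℝ≥0∞ :=
  worstCaseError P p a b (fun ω q' => explicitEuler a b n (fun j => τ j ω) q')
    (ivpClass a b d ρ K L (ENNReal.ofReal (radiusZero a b K)))
    (noisyData (noiseOne a b d δ) δ)

/-- `e^{(p)}(l^{IE}, F^ρ_∞, V^2, δ)` for the scheme with `n` steps and sample `τ`. -/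
def errorImplicit {Ω : Type*} [MeasurableSpace Ω] (P : Measure Ω) (τ : ℕ → Ω → ℝ)
    (p a b : ℝ) (d : ℕ) (ρ K L : ℝ) (n : ℕ) (δ : ℝ) : ℝ≥0∞ :=
  worstCaseError P p a b (fun ω q' => implicitEuler a b n (fun j => τ j ω) q')
    (ivpClass a b d ρ K L ∞)
    (noisyData (noiseTwo a b d δ) δ)

end RandEuler

end

/-! Upper bound. Subtracting the scheme from the solution at the grid points splits the error into
the initial perturbation, the error of the randomized quadrature rule for `t ↦ f t (z t)`, and terms
comparing `f` along `z` with the noisy `f` along the scheme at the same random nodes. Lipschitz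
continuity and a discrete Gronwall inequality (`le_of_le_add_mul_sum`) reduce this, path by path, to
the quadrature error plus O(h + δ). The O(h) comes from using a grid value in place of the value at
the node, and from linear interpolation (`IsIVP.norm_solution_sub_interpolate_le`).

A uniform node makes each quadrature step unbiased, of size O(h^(ρ+1)), and the steps are
independent. The partial sums are therefore sub-Gaussian with variance proxy O(n^(-1-2ρ)). Moments
of order 2m control all d(n+1) coordinates of partial sums at once, at the price of a factor
n^(1/(2m)). Since ρ > 1/2, a large m still leaves O(1/n) (`moment_bound`), so no sharper maximal
inequality is needed.

Lower bound. On the autonomous problems z' = ±l z the random nodes drop out, and the schemes become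
the classical Euler methods with error of exact order 1/n. The zero field with a perturbed initial
value produces the δ. Since ρ + 1/2 > 1, the term 1/n excludes the faster rate. -/

noncomputable section

namespace RandEuler

/-! ### Radial retraction onto a ball -/

section Retraction

variable {E : Type*} [NormedAddCommGroup E] [NormedSpace ℝ E]

/-- The radial retraction of a normed space onto the closed ball of radius `R` about `c`. -/
def radialRetraction (c : E) (R : ℝ) (x : E) : E := c + (R / max R ‖x - c‖) • (x - c)

theorem radialRetraction_sub_norm {c : E} {R : ℝ} (hR : 0 < R) (x : E) :
    ‖radialRetraction c R x - c‖ = R / max R ‖x - c‖ * ‖x - c‖ := by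
  have : 0 < max R ‖x - c‖ := lt_max_of_lt_left hR
  rw [radialRetraction, add_sub_cancel_left, norm_smul, Real.norm_of_nonneg (by positivity)]

theorem norm_radialRetraction_sub_le {c : E} {R : ℝ} (hR : 0 < R) (x : E) :
    ‖radialRetraction c R x - c‖ ≤ R := by
  have h : 0 < max R ‖x - c‖ := lt_max_of_lt_left hR
  rw [radialRetraction_sub_norm hR, div_mul_eq_mul_div, div_le_iff₀ h]
  gcongr
  exact le_max_right _ _

theorem norm_radialRetraction_sub_le_norm {c : E} {R : ℝ} (hR : 0 < R) (x : E) :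
    ‖radialRetraction c R x - c‖ ≤ ‖x - c‖ := by
  have h : 0 < max R ‖x - c‖ := lt_max_of_lt_left hR
  rw [radialRetraction_sub_norm hR]
  refine mul_le_of_le_one_left (norm_nonneg _) ?_
  rw [div_le_one h]
  exact le_max_left _ _

theorem radialRetraction_eq_self {c : E} {R : ℝ} (hR : 0 < R) {x : E} (hx : ‖x - c‖ ≤ R) :
    radialRetraction c R x = x := by
  rw [radialRetraction, max_eq_left hx, div_self hR.ne', one_smul, add_sub_cancel]

/-- Moving the point with the scaling factor fixed costs ‖x - y‖, and so does changing the factor at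
a fixed point. The constant 2 suffices here; constant 1 is special to inner product spaces and is
not available for the one norm. -/
theorem norm_radialRetraction_sub_radialRetraction_le {c : E} {R : ℝ} (hR : 0 < R) (x y : E) :
    ‖radialRetraction c R x - radialRetraction c R y‖ ≤ 2 * ‖x - y‖ := by
  have hx : 0 < max R ‖x - c‖ := lt_max_of_lt_left hR
  have hy : 0 < max R ‖y - c‖ := lt_max_of_lt_left hR
  have key : radialRetraction c R x - radialRetraction c R y =
      (R / max R ‖x - c‖) • (x - y) +
        (R / max R ‖x - c‖ - R / max R ‖y - c‖) • (y - c) := by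
    simp only [radialRetraction]
    module
  have h1 : ‖(R / max R ‖x - c‖) • (x - y)‖ ≤ ‖x - y‖ := by
    rw [norm_smul, Real.norm_of_nonneg (by positivity)]
    refine mul_le_of_le_one_left (norm_nonneg _) ?_
    rw [div_le_one hx]
    exact le_max_left _ _
  have h2 : ‖(R / max R ‖x - c‖ - R / max R ‖y - c‖) • (y - c)‖ ≤ ‖x - y‖ := by
    have h3 : R / max R ‖x - c‖ - R / max R ‖y - c‖ =
        (R / max R ‖x - c‖) * ((max R ‖y - c‖ - max R ‖x - c‖) / max R ‖y - c‖) := by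
      field_simp
    have h4 : |max R ‖y - c‖ - max R ‖x - c‖| ≤ ‖x - y‖ := by
      rw [max_comm R, max_comm R]
      refine (abs_max_sub_max_le_abs ..).trans ((abs_norm_sub_norm_le _ _).trans ?_)
      rw [sub_sub_sub_cancel_right, norm_sub_rev]
    rw [norm_smul, h3, Real.norm_eq_abs, abs_mul, abs_div _ (max R ‖y - c‖), abs_of_pos hy,
      abs_of_pos (div_pos hR hx)]
    have h5 : R / max R ‖x - c‖ ≤ 1 := by
      rw [div_le_one hx]
      exact le_max_left _ _
    calc R / max R ‖x - c‖ * (|max R ‖y - c‖ - max R ‖x - c‖| / max R ‖y - c‖) * ‖y - c‖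
        ≤ 1 * (‖x - y‖ / max R ‖y - c‖) * max R ‖y - c‖ := by
          gcongr
          exact le_max_right _ _
      _ = ‖x - y‖ := by field_simp
  rw [key]
  linarith [norm_add_le ((R / max R ‖x - c‖) • (x - y))
    ((R / max R ‖x - c‖ - R / max R ‖y - c‖) • (y - c))]

end Retraction

/-! ### Existence, a priori bounds and regularity of solutions -/

section Solutions

variable {a b : ℝ} {d : ℕ} {ρ K L : ℝ} {R : ℝ≥0∞} {η : Vec d} {f : Field d} {z : ℝ → Vec d}

/-- The radius of a ball about the initial value that no solution leaves. -/
def solutionRadius (a b K : ℝ) : ℝ := (1 + K) * (Real.exp (K * (b - a)) - 1)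

/-- Gronwall for `w - w a`. It is stated for arbitrary curves because it serves both the solutions
of the original equation and those of the truncated one. -/
theorem norm_sub_init_le {E : Type*} [NormedAddCommGroup E] [NormedSpace ℝ E]
    (hK : 0 < K) {w v : ℝ → E}
    (hw : ∀ t ∈ Icc a b, HasDerivWithinAt w (v t) (Icc a b) t)
    (hv : ∀ t ∈ Icc a b, ‖v t‖ ≤ K * ‖w t - w a‖ + K * (1 + K)) {t : ℝ} (ht : t ∈ Icc a b) :
    ‖w t - w a‖ ≤ solutionRadius a b K := by
  have hc : ContinuousOn (fun s => w s - w a) (Icc a b) := fun s hs =>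
    ((hw s hs).continuousWithinAt).sub continuousWithinAt_const
  have hd : ∀ s ∈ Ico a b, HasDerivWithinAt (fun s => w s - w a) (v s) (Ici s) s := by
    intro s hs
    exact (((hw s (Ico_subset_Icc_self hs)).mono_of_mem_nhdsWithin
      (Icc_mem_nhdsGE_of_mem hs))).sub_const _
  have := norm_le_gronwallBound_of_norm_deriv_right_le (δ := 0) (K := K) (ε := K * (1 + K)) hc hd
    (by simp) (fun s hs => hv s (Ico_subset_Icc_self hs)) t ht
  refine this.trans ?_
  simp only [gronwallBound_of_K_ne_0 hK.ne', solutionRadius]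
  have : Real.exp (K * (t - a)) ≤ Real.exp (K * (b - a)) := by
    gcongr
    exact ht.2
  rw [mul_div_cancel_left₀ _ hK.ne', zero_mul, zero_add]
  gcongr

theorem IsIVP.norm_solution_sub_init_le (hK : 0 < K) (h : IsIVP a b ρ K L R η f)
    (hz : IsSolution a b (η, f) z) {t : ℝ} (ht : t ∈ Icc a b) :
    ‖z t - η‖ ≤ solutionRadius a b K := by
  have hza : z a = η := hz.1
  rw [← hza]
  refine norm_sub_init_le hK hz.2 (fun s hs => (h.growth s hs _).trans ?_) ht
  have h1 : ‖z s‖ ≤ ‖z s - z a‖ + K := by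
    have := norm_le_norm_sub_add (z s) (z a)
    have h2 := h.init_bound
    rw [← hza] at h2
    linarith
  nlinarith

theorem IsIVP.norm_solution_le (hK : 0 < K) (h : IsIVP a b ρ K L R η f)
    (hz : IsSolution a b (η, f) z) {t : ℝ} (ht : t ∈ Icc a b) :
    1 + ‖z t‖ ≤ (1 + K) * Real.exp (K * (b - a)) := by
  have h1 := h.norm_solution_sub_init_le hK hz ht
  have h2 := norm_le_norm_sub_add (z t) η
  have h3 := h.init_bound
  rw [solutionRadius] at h1
  linarith

theorem IsIVP.enorm_solution_sub_init_le (hK : 0 < K)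
    (hR : ENNReal.ofReal (solutionRadius a b K) ≤ R) (h : IsIVP a b ρ K L R η f)
    (hz : IsSolution a b (η, f) z) {t : ℝ} (ht : t ∈ Icc a b) : ‖z t - η‖ₑ ≤ R := by
  refine le_trans ?_ hR
  rw [← ofReal_norm]
  exact ENNReal.ofReal_le_ofReal (h.norm_solution_sub_init_le hK hz ht)

theorem IsIVP.continuousOn_comp (h : IsIVP a b ρ K L R η f) {w : ℝ → Vec d}
    (hw : ContinuousOn w (Icc a b)) : ContinuousOn (fun t => f t (w t)) (Icc a b) :=
  h.cont.comp (f := fun t => (t, w t)) (continuousOn_id.prodMk hw) (fun _ ht => ⟨ht, mem_univ _⟩)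

/-- Composing `f` with the retraction onto the ball of radius `solutionRadius` gives a bounded,
globally Lipschitz field, so Picard–Lindelöf applies on the whole interval. The truncated field
obeys the same growth bound, so its solution never leaves the ball and solves the original equation.
-/
theorem IsIVP.exists_isSolution (hab : a < b) (hK : 0 < K) (hL : 0 < L)
    (hR : ENNReal.ofReal (solutionRadius a b K) ≤ R) (h : IsIVP a b ρ K L R η f) :
    ∃ z, IsSolution a b (η, f) z := by
  set r := solutionRadius a b K with hr
  have hr0 : 0 < r := by
    have : 1 < Real.exp (K * (b - a)) := Real.one_lt_exp_iff.2 (mul_pos hK (sub_pos.2 hab))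
    exact mul_pos (by linarith) (by linarith)
  have hmem : ∀ x, ‖radialRetraction η r x - η‖ₑ ≤ R := fun x => by
    refine le_trans ?_ hR
    rw [← ofReal_norm]
    exact ENNReal.ofReal_le_ofReal (norm_radialRetraction_sub_le hr0 x)
  have hgr : ∀ t ∈ Icc a b, ∀ x, ‖f t (radialRetraction η r x)‖ ≤
      K * ‖radialRetraction η r x - η‖ + K * (1 + K) := by
    intro t ht x
    have h1 := h.growth t ht (radialRetraction η r x)
    have h2 := norm_le_norm_sub_add (radialRetraction η r x) η
    have h3 := h.init_bound
    nlinarith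
  let M : NNReal := ⟨K * r + K * (1 + K), by positivity⟩
  -- With radius `M * (b - a)` the curve cannot leave the Picard–Lindelöf ball before time `b`.
  let A : NNReal := ⟨(K * r + K * (1 + K)) * (b - a), mul_nonneg (by positivity) (by linarith)⟩
  have hPL : IsPicardLindelof (fun t x => f t (radialRetraction η r x))
      (⟨a, left_mem_Icc.2 hab.le⟩ : Icc a b) η A 0 M ⟨2 * L, by positivity⟩ := by
    refine ⟨fun t ht => ?_, fun x _ => ?_, fun t ht x _ => ?_, ?_⟩
    · refine LipschitzOnWith.of_dist_le_mul fun x _ y _ => ?_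
      rw [dist_eq_norm, dist_eq_norm]
      refine (h.lipschitz_space t ht _ _ (hmem x) (hmem y)).trans ?_
      have := norm_radialRetraction_sub_radialRetraction_le (c := η) hr0 x y
      change _ ≤ 2 * L * _
      nlinarith
    · exact h.continuousOn_comp continuousOn_const
    · refine (hgr t ht x).trans ?_
      change _ ≤ K * r + K * (1 + K)
      have := norm_radialRetraction_sub_le (c := η) hr0 x
      gcongr
    · change (K * r + K * (1 + K)) * max (b - a) (a - a) ≤
        (K * r + K * (1 + K)) * (b - a) - 0
      rw [sub_self, max_eq_left (by linarith), sub_zero]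
  obtain ⟨z, hza, hz⟩ := hPL.exists_eq_forall_mem_Icc_hasDerivWithinAt₀
  have hza' : z a = η := hza
  refine ⟨z, hza', fun t ht => ?_⟩
  have hle : ‖z t - z a‖ ≤ r := by
    refine norm_sub_init_le hK hz (fun s hs => (hgr s hs _).trans ?_) ht
    rw [hza']
    have := norm_radialRetraction_sub_le_norm (c := η) hr0 (z s)
    gcongr
  have := hz t ht
  rw [hza'] at hle
  simpa only [radialRetraction_eq_self hr0 hle] using this

theorem IsIVP.isSolution_solution (hab : a < b) (hK : 0 < K) (hL : 0 < L)
    (hR : ENNReal.ofReal (solutionRadius a b K) ≤ R) (h : IsIVP a b ρ K L R η f) :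
    IsSolution a b (η, f) (solution a b (η, f)) :=
  Classical.epsilon_spec (h.exists_isSolution hab hK hL hR)

theorem IsSolution.continuousOn (hz : IsSolution a b (η, f) z) : ContinuousOn z (Icc a b) :=
  fun t ht => (hz.2 t ht).continuousWithinAt

/-- A bound for the speed of the solutions. -/
def speedBound (a b K : ℝ) : ℝ := K * ((1 + K) * Real.exp (K * (b - a)))

theorem speedBound_pos (hK : 0 < K) : 0 < speedBound a b K := by
  unfold speedBound; positivity

theorem IsIVP.norm_solution_sub_le (hK : 0 < K) (h : IsIVP a b ρ K L R η f)
    (hz : IsSolution a b (η, f) z) {s t : ℝ} (hs : s ∈ Icc a b) (ht : t ∈ Icc a b) :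
    ‖z t - z s‖ ≤ speedBound a b K * |t - s| := by
  refine Convex.norm_image_sub_le_of_norm_hasDerivWithin_le hz.2 (fun x hx => ?_)
    (convex_Icc a b) hs ht
  refine (h.growth x hx _).trans ?_
  rw [speedBound]
  gcongr
  exact h.norm_solution_le hK hz hx

/-- A Hölder constant of order `ρ`, for steps of length at most one, of `t ↦ f t (z t)`. -/
def slopeConst (a b K L : ℝ) : ℝ := L * (1 + speedBound a b K)

theorem slopeConst_pos (hK : 0 < K) (hL : 0 < L) : 0 < slopeConst a b K L := by
  have := speedBound_pos (a := a) (b := b) hK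
  unfold slopeConst; positivity

/-- Time is changed first at fixed `z t`, then space; the second error is linear in `h'` and is
absorbed in `h' ^ ρ` because `h' ≤ 1`. -/
theorem IsIVP.norm_slope_sub_le (hK : 0 < K) (hL : 0 < L) (hρ : 0 < ρ) (hρ1 : ρ ≤ 1)
    (hR : ENNReal.ofReal (solutionRadius a b K) ≤ R) (h : IsIVP a b ρ K L R η f)
    (hz : IsSolution a b (η, f) z) {s t h' : ℝ} (hs : s ∈ Icc a b) (ht : t ∈ Icc a b)
    (hst : |t - s| ≤ h') (hh : h' ≤ 1) :
    ‖f t (z t) - f s (z s)‖ ≤ slopeConst a b K L * h' ^ ρ := by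
  have hz1 := h.enorm_solution_sub_init_le hK hR hz hs
  have hz2 := h.enorm_solution_sub_init_le hK hR hz ht
  have h1 := h.holder_time t ht s hs _ hz2
  have h2 := h.lipschitz_space s hs _ _ hz2 hz1
  have h3 := h.norm_solution_sub_le hK hz hs ht
  have h0 : 0 ≤ |t - s| := abs_nonneg _
  have hp := speedBound_pos (a := a) (b := b) hK
  have h4 : h' ≤ h' ^ ρ := by
    simpa using Real.rpow_le_rpow_of_exponent_ge_of_imp (h0.trans hst) hh hρ1
      (fun _ h0' => absurd h0' one_ne_zero)
  have h5 : |t - s| ^ ρ ≤ h' ^ ρ := by gcongr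
  calc ‖f t (z t) - f s (z s)‖ ≤ ‖f t (z t) - f s (z t)‖ + ‖f s (z t) - f s (z s)‖ :=
        norm_sub_le_norm_sub_add_norm_sub ..
    _ ≤ L * h' ^ ρ + L * (speedBound a b K * h' ^ ρ) := by
        refine add_le_add (h1.trans (by gcongr)) (h2.trans ?_)
        gcongr
        exact h3.trans (by gcongr; linarith)
    _ = _ := by rw [slopeConst]; ring

/-- The remainder of one step of a one-point quadrature rule. -/
theorem IsIVP.norm_step_remainder_le (hK : 0 < K) (hL : 0 < L) (hρ : 0 < ρ) (hρ1 : ρ ≤ 1)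
    (hR : ENNReal.ofReal (solutionRadius a b K) ≤ R) (h : IsIVP a b ρ K L R η f)
    (hz : IsSolution a b (η, f) z) {s h' θ : ℝ} (hs : a ≤ s) (hsb : s + h' ≤ b)
    (hh0 : 0 ≤ h') (hh : h' ≤ 1) (hθ : θ ∈ Icc s (s + h')) :
    ‖z (s + h') - z s - h' • f θ (z θ)‖ ≤ slopeConst a b K L * h' ^ ρ * h' := by
  have hsub : Icc s (s + h') ⊆ Icc a b := Icc_subset_Icc hs hsb
  -- Subtracting the linear function with slope `f θ (z θ)` leaves a curve whose derivative is a
  -- difference of slopes, so the mean value inequality gives the remainder.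
  have hder : ∀ t ∈ Icc s (s + h'), HasDerivWithinAt (fun t => z t - t • f θ (z θ))
      (f t (z t) - f θ (z θ)) (Icc s (s + h')) t := by
    intro t ht
    have := ((hz.2 t (hsub ht)).mono hsub).sub
      ((hasDerivWithinAt_id t (Icc s (s + h'))).smul_const (f θ (z θ)))
    rwa [one_smul] at this
  have := Convex.norm_image_sub_le_of_norm_hasDerivWithin_le hder
    (C := slopeConst a b K L * h' ^ ρ) (fun t ht => ?_) (convex_Icc _ _)
    (left_mem_Icc.2 (by linarith)) (right_mem_Icc.2 (by linarith))
  · rw [add_sub_cancel_left, Real.norm_of_nonneg hh0] at this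
    refine le_trans (le_of_eq ?_) this
    congr 1
    module
  · refine h.norm_slope_sub_le hK hL hρ hρ1 hR hz (hsub hθ) (hsub ht) ?_ hh
    rw [abs_le]
    constructor <;> linarith [ht.1, ht.2, hθ.1, hθ.2]

end Solutions

/-! ### Discrete Gronwall inequalities -/

section DiscreteGronwall

theorem le_mul_exp_of_succ_le {u : ℕ → ℝ} {y : ℝ} {n : ℕ} (hy : 0 ≤ y) (hu : 0 ≤ u 0)
    (h : ∀ j < n, u (j + 1) ≤ (1 + y) * u j) : ∀ j ≤ n, u j ≤ u 0 * Real.exp (y * j) := by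
  intro j hj
  induction j with
  | zero => simp
  | succ j ih =>
    have h1 := ih (by omega)
    have h2 : 1 + y ≤ Real.exp y := by linarith [Real.add_one_le_exp y]
    have h3 : Real.exp (y * (j + 1 : ℕ)) = Real.exp y * Real.exp (y * j) := by
      rw [← Real.exp_add]; congr 1; push_cast; ring
    calc u (j + 1) ≤ (1 + y) * u j := h j (by omega)
      _ ≤ (1 + y) * (u 0 * Real.exp (y * j)) := by gcongr
      _ ≤ Real.exp y * (u 0 * Real.exp (y * j)) := by gcongr
      _ = _ := by rw [h3]; ring

theorem add_mul_sum_pow (B x : ℝ) (k : ℕ) :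
    B + x * ∑ j ∈ Finset.range k, B * (1 + x) ^ j = B * (1 + x) ^ k := by
  induction k with
  | zero => simp
  | succ k ih => rw [Finset.sum_range_succ, mul_add, ← add_assoc, ih]; ring

/-- A discrete Gronwall inequality for explicit (`i = 0`) and implicit (`i = 1`) schemes. -/
theorem le_of_le_add_mul_sum {e : ℕ → ℝ} {A c : ℝ} {n i : ℕ} (he : ∀ k, 0 ≤ e k) (hA : 0 ≤ A)
    (hc : 0 ≤ c) (hc2 : c ≤ 1 / 2) (hi : i ≤ 1)
    (h : ∀ k ≤ n, e k ≤ A + c * ∑ j ∈ Finset.range k, e (j + i)) :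
    ∀ k ≤ n, e k ≤ 2 * A * Real.exp (2 * (c * n)) := by
  -- In the implicit case the sum contains `e k` itself, with weight `c ≤ 1/2`; moving it to the
  -- left doubles the constants and leaves an explicit recursion.
  have hstep : ∀ k ≤ n, e k ≤ 2 * A + 2 * c * ∑ j ∈ Finset.range k, e j := by
    intro k hk
    have h1 : ∑ j ∈ Finset.range k, e (j + i) ≤ ∑ j ∈ Finset.range k, e j + e k := by
      rw [← Finset.sum_range_succ]
      obtain rfl | rfl : i = 0 ∨ i = 1 := by omega
      · exact Finset.sum_le_sum_of_subset_of_nonneg (Finset.range_mono (Nat.le_succ k))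
          (fun j _ _ => he j)
      · rw [Finset.sum_range_succ']
        linarith [he 0]
    have h2 := h k hk
    have h3 := he k
    have h4 := mul_le_mul_of_nonneg_left h1 hc
    nlinarith
  have hpow : ∀ k ≤ n, e k ≤ 2 * A * (1 + 2 * c) ^ k := by
    intro k
    induction k using Nat.strong_induction_on with
    | _ k ih =>
      intro hk
      refine (hstep k hk).trans ?_
      rw [← add_mul_sum_pow]
      gcongr with j hj
      have := Finset.mem_range.1 hj
      exact ih j this (by omega)
  intro k hk
  refine (hpow k hk).trans ?_
  gcongr
  calc (1 + 2 * c) ^ k ≤ (Real.exp (2 * c)) ^ k := by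
        gcongr
        linarith [Real.add_one_le_exp (2 * c)]
    _ = Real.exp (k * (2 * c)) := (Real.exp_nat_mul _ _).symm
    _ ≤ _ := by
        apply Real.exp_le_exp.2
        have : (k : ℝ) ≤ n := by exact_mod_cast hk
        nlinarith

end DiscreteGronwall

/-! ### Grid, random nodes and linear interpolation -/

section Interpolation

variable {a b : ℝ} {d n : ℕ}

/-- The grid point `t_j = a + j h`. -/
def gridPoint (a b : ℝ) (n j : ℕ) : ℝ := a + j * ((b - a) / n)

theorem gridPoint_zero : gridPoint a b n 0 = a := by simp [gridPoint]

theorem gridPoint_succ (j : ℕ) : gridPoint a b n (j + 1) = gridPoint a b n j + (b - a) / n := by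
  simp only [gridPoint]; push_cast; ring

theorem gridPoint_self (hn : 1 ≤ n) : gridPoint a b n n = b := by
  have : (n : ℝ) ≠ 0 := by positivity
  rw [gridPoint]; field_simp; ring

theorem gridPoint_mem (hab : a < b) (hn : 1 ≤ n) {j : ℕ} (hj : j ≤ n) :
    gridPoint a b n j ∈ Icc a b := by
  have h0 : 0 ≤ (b - a) / n := div_nonneg (by linarith) (by positivity)
  have h1 : (j : ℝ) ≤ n := by exact_mod_cast hj
  constructor
  · rw [gridPoint]; nlinarith [mul_nonneg (Nat.cast_nonneg (α := ℝ) j) h0]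
  · have e := gridPoint_self (a := a) (b := b) hn
    rw [gridPoint] at e ⊢
    linarith [mul_le_mul_of_nonneg_right h1 h0]

theorem node_succ (τ : ℕ → ℝ) (j : ℕ) :
    node a b n τ (j + 1) = gridPoint a b n j + τ (j + 1) * ((b - a) / n) := by
  simp only [node, gridPoint]; push_cast; ring

theorem node_succ_mem (hab : a < b) {τ : ℕ → ℝ} {j : ℕ} (hτ : τ (j + 1) ∈ Icc (0 : ℝ) 1) :
    node a b n τ (j + 1) ∈ Icc (gridPoint a b n j) (gridPoint a b n (j + 1)) := by
  have h0 : 0 ≤ (b - a) / n := div_nonneg (by linarith) (by positivity)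
  rw [node_succ, gridPoint_succ]
  constructor
  · nlinarith [mul_nonneg hτ.1 h0]
  · nlinarith [mul_le_mul_of_nonneg_right hτ.2 h0]

theorem interpolate_right (hab : a < b) (hn : 1 ≤ n) (w : ℕ → Vec d) :
    interpolate a b n w b = w n := by
  have hn' : (n : ℝ) ≠ 0 := by positivity
  have hba : b - a ≠ 0 := (sub_pos.2 hab).ne'
  have h1 : (b - a) / ((b - a) / n) = n := by field_simp
  have h2 : min ⌊(b - a) / ((b - a) / n)⌋₊ (n - 1) = n - 1 := by
    rw [h1, Nat.floor_natCast]; omega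
  have h3 : (b - (a + ((n - 1 : ℕ) : ℝ) * ((b - a) / n))) / ((b - a) / n) = 1 := by
    rw [Nat.cast_sub hn]
    field_simp
    push_cast; ring
  rw [interpolate, h2, h3, one_smul, Nat.sub_add_cancel hn, add_sub_cancel]

/-- The interpolant is a convex combination of the two neighbouring grid values, and `z` moves by at
most `D * h` between `t` and either grid point. -/
theorem norm_sub_interpolate_le (hab : a < b) (hn : 1 ≤ n) {z : ℝ → Vec d} {w : ℕ → Vec d}
    {D E : ℝ} (hD : 0 ≤ D)
    (hz : ∀ s ∈ Icc a b, ∀ t ∈ Icc a b, ‖z t - z s‖ ≤ D * |t - s|)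
    (hw : ∀ k ≤ n, ‖z (gridPoint a b n k) - w k‖ ≤ E) {t : ℝ} (ht : t ∈ Icc a b) :
    ‖z t - interpolate a b n w t‖ ≤ E + D * ((b - a) / n) := by
  have hn' : (0 : ℝ) < n := by positivity
  have hh : 0 < (b - a) / n := div_pos (by linarith) hn'
  set h := (b - a) / n with hdef
  obtain ⟨k, hk⟩ : ∃ k, k = min ⌊(t - a) / h⌋₊ (n - 1) := ⟨_, rfl⟩
  have hkn : k + 1 ≤ n := by omega
  have hta : 0 ≤ (t - a) / h := div_nonneg (by linarith [ht.1]) hh.le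
  have hlow : (k : ℝ) * h ≤ t - a := by
    rw [← le_div_iff₀ hh]
    refine le_trans ?_ (Nat.floor_le hta)
    exact_mod_cast hk ▸ min_le_left _ _
  have hupp : t - a ≤ (k + 1) * h := by
    -- When the cap `n - 1` takes over, `t` lies in the last interval; this includes `t = b`, where
    -- the floor is `n`.
    rcases le_total ⌊(t - a) / h⌋₊ (n - 1) with hc | hc
    · rw [min_eq_left hc] at hk
      rw [← div_le_iff₀ hh, hk]
      exact (Nat.lt_floor_add_one _).le
    · rw [min_eq_right hc] at hk
      have : (k : ℝ) + 1 = n := by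
        have : k + 1 = n := by omega
        exact_mod_cast this
      rw [this, hdef, mul_div_cancel₀ _ hn'.ne']
      linarith [ht.2]
  set l := (t - (a + (k : ℝ) * h)) / h with hl
  have hl0 : 0 ≤ l := div_nonneg (by linarith) hh.le
  have hl1 : l ≤ 1 := by rw [hl, div_le_one hh]; linarith
  have hint : interpolate a b n w t = w k + l • (w (k + 1) - w k) := by
    rw [interpolate, ← hdef, ← hk]
  have e1 : ‖z t - w k‖ ≤ E + D * h := by
    have h1 := hz _ (gridPoint_mem hab hn (j := k) (by omega)) t ht
    have h2 := hw k (by omega)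
    have h3 : |t - gridPoint a b n k| ≤ h := by
      rw [gridPoint, ← hdef, abs_le]; constructor <;> linarith
    have h4 := norm_sub_le_norm_sub_add_norm_sub (z t) (z (gridPoint a b n k)) (w k)
    linarith [mul_le_mul_of_nonneg_left h3 hD]
  have e2 : ‖z t - w (k + 1)‖ ≤ E + D * h := by
    have h1 := hz _ (gridPoint_mem hab hn hkn) t ht
    have h2 := hw (k + 1) hkn
    have h3 : |t - gridPoint a b n (k + 1)| ≤ h := by
      rw [gridPoint, ← hdef, abs_le]; push_cast; constructor <;> linarith
    have h4 := norm_sub_le_norm_sub_add_norm_sub (z t) (z (gridPoint a b n (k + 1))) (w (k + 1))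
    linarith [mul_le_mul_of_nonneg_left h3 hD]
  have key : z t - interpolate a b n w t = (1 - l) • (z t - w k) + l • (z t - w (k + 1)) := by
    rw [hint]; module
  rw [key]
  refine (norm_add_le _ _).trans ?_
  rw [norm_smul, norm_smul, Real.norm_of_nonneg hl0, Real.norm_of_nonneg (by linarith : 0 ≤ 1 - l)]
  nlinarith

end Interpolation

/-! ### Pathwise error in terms of the quadrature error -/

section Schemes

variable {a b : ℝ} {d n : ℕ} {ρ K L δ : ℝ} {R : ℝ≥0∞} {η : Vec d} {f : Field d} {z : ℝ → Vec d}

/-- The error after `k` steps of the randomized quadrature rule for `∫ f(t, z(t)) dt`. -/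
def quadratureError (a b : ℝ) (n : ℕ) (f : Field d) (z : ℝ → Vec d) (θ : ℕ → ℝ) (k : ℕ) :
    Vec d :=
  ∑ j ∈ Finset.range k, (z (gridPoint a b n (j + 1)) - z (gridPoint a b n j) -
    ((b - a) / n) • f (θ (j + 1)) (z (θ (j + 1))))

/-- A bound for one plus the norm of the values of the schemes. -/
def valueBound (a b K : ℝ) : ℝ := (K + 2) * Real.exp (2 * (K + 1) * (b - a))

/-- A bound for the error of a scheme in terms of a bound `M` for the quadrature error, the step
size `h` and the noise level `δ`. -/
def pathBound (a b K L M h δ : ℝ) : ℝ :=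
  2 * (δ + M + (b - a) * (L * (speedBound a b K * h) + δ * valueBound a b K)) *
    Real.exp (2 * (L * (b - a))) + speedBound a b K * h

/-- The error bound for the interpolated values of explicit (`i = 0`) and implicit (`i = 1`)
schemes. -/
theorem IsIVP.norm_solution_sub_interpolate_le (hab : a < b) (hn : 1 ≤ n) (hK : 0 < K)
    (hL : 0 < L) (hR : ENNReal.ofReal (solutionRadius a b K) ≤ R) (h : IsIVP a b ρ K L R η f)
    (hz : IsSolution a b (η, f) z) (hδ : 0 ≤ δ) (hstep : L * ((b - a) / n) ≤ 1 / 2)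
    {i : ℕ} (hi : i ≤ 1) {g : Field d} (hg : ∀ t ∈ Icc a b, ∀ y, ‖g t y‖ ≤ δ * (1 + ‖y‖))
    {θ : ℕ → ℝ} (hθ : ∀ j < n, θ (j + 1) ∈ Icc (gridPoint a b n j) (gridPoint a b n (j + 1)))
    {w : ℕ → Vec d} (hw0 : ‖w 0 - η‖ ≤ δ)
    (hw : ∀ j < n, w (j + 1) = w j + ((b - a) / n) •
      (f (θ (j + 1)) (w (j + i)) + g (θ (j + 1)) (w (j + i))))
    (hwR : ∀ j < n, ‖w (j + i) - η‖ₑ ≤ R) (hwb : ∀ j ≤ n, 1 + ‖w j‖ ≤ valueBound a b K)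
    {M : ℝ} (hM : ∀ k ≤ n, ‖quadratureError a b n f z θ k‖ ≤ M) {t : ℝ} (ht : t ∈ Icc a b) :
    ‖z t - interpolate a b n w t‖ ≤ pathBound a b K L M ((b - a) / n) δ := by
  have hn' : (0 : ℝ) < n := by positivity
  have hh : 0 < (b - a) / n := div_pos (by linarith) hn'
  have hza : z a = η := hz.1
  have hM0 : 0 ≤ M := (norm_nonneg _).trans (hM 0 (by omega))
  have hp := speedBound_pos (a := a) (b := b) hK
  have hv : 0 ≤ valueBound a b K := by unfold valueBound; positivity
  have hba : 0 < b - a := by linarith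
  have hθm : ∀ j < n, θ (j + 1) ∈ Icc a b := fun j hj =>
    ⟨(gridPoint_mem hab hn hj.le).1.trans (hθ j hj).1,
      (hθ j hj).2.trans (gridPoint_mem hab hn hj).2⟩
  refine norm_sub_interpolate_le hab hn hp.le
    (fun s hs t ht => h.norm_solution_sub_le hK hz hs ht) ?_ ht
  -- The Gronwall weight is `c = L * h`, so the exponent must be read as `2 * (c * n)`.
  have hnh : L * ((b - a) / n) * n = L * (b - a) := by field_simp
  rw [← hnh]
  refine le_of_le_add_mul_sum (fun k => norm_nonneg _) (by positivity) (by positivity) hstep hi ?_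
  intro k hk
  -- Telescoping: initial error, quadrature error, and the accumulated discrepancy of the two
  -- right-hand sides at the same nodes.
  have hid : ∀ k ≤ n, z (gridPoint a b n k) - w k = (η - w 0) + quadratureError a b n f z θ k +
      ∑ j ∈ Finset.range k, ((b - a) / n) • ((f (θ (j + 1)) (z (θ (j + 1))) -
        f (θ (j + 1)) (w (j + i))) - g (θ (j + 1)) (w (j + i))) := by
    intro k hk
    induction k with
    | zero => simp [quadratureError, gridPoint_zero, hza]
    | succ k ih =>
      have ih' := ih (by omega)
      rw [quadratureError] at ih' ⊢
      rw [Finset.sum_range_succ, Finset.sum_range_succ, hw k (by omega)]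
      have e : z (gridPoint a b n (k + 1)) - (w k + ((b - a) / n) •
          (f (θ (k + 1)) (w (k + i)) + g (θ (k + 1)) (w (k + i)))) =
          (z (gridPoint a b n k) - w k) + (z (gridPoint a b n (k + 1)) - z (gridPoint a b n k)) -
          ((b - a) / n) • (f (θ (k + 1)) (w (k + i)) + g (θ (k + 1)) (w (k + i))) := by abel
      rw [e, ih']
      module
  have hterm : ∀ j < n, ‖((b - a) / n) • ((f (θ (j + 1)) (z (θ (j + 1))) -
        f (θ (j + 1)) (w (j + i))) - g (θ (j + 1)) (w (j + i)))‖ ≤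
      (b - a) / n * (L * (speedBound a b K * ((b - a) / n)) + δ * valueBound a b K) +
        L * ((b - a) / n) * ‖z (gridPoint a b n (j + i)) - w (j + i)‖ := by
    intro j hj
    rw [norm_smul, Real.norm_of_nonneg hh.le]
    have h1 := h.lipschitz_space _ (hθm j hj) (z (θ (j + 1))) (w (j + i))
      (h.enorm_solution_sub_init_le hK hR hz (hθm j hj)) (hwR j hj)
    have h2 : ‖g (θ (j + 1)) (w (j + i))‖ ≤ δ * valueBound a b K :=
      (hg _ (hθm j hj) _).trans (by gcongr; exact hwb _ (by omega))
    -- The scheme uses the grid value with index `j + i` in place of the value at the node. This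
    -- replacement costs `L * speedBound * h` in the slope, a first-order term that does not average
    -- out in this estimate.
    have h3 := h.norm_solution_sub_le hK hz
      (gridPoint_mem hab hn (j := j + i) (by omega)) (hθm j hj)
    have h4 : |θ (j + 1) - gridPoint a b n (j + i)| ≤ (b - a) / n := by
      have := hθ j hj
      rw [gridPoint_succ] at this
      obtain rfl | rfl : i = 0 ∨ i = 1 := by omega
      · rw [abs_le]; constructor <;> simp only [add_zero] <;> linarith [this.1, this.2]
      · rw [abs_le, gridPoint_succ]; constructor <;> linarith [this.1, this.2]
    have h5 := norm_sub_le_norm_sub_add_norm_sub (z (θ (j + 1))) (z (gridPoint a b n (j + i)))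
      (w (j + i))
    calc (b - a) / n * ‖f (θ (j + 1)) (z (θ (j + 1))) - f (θ (j + 1)) (w (j + i)) -
          g (θ (j + 1)) (w (j + i))‖
        ≤ (b - a) / n * (L * (speedBound a b K * ((b - a) / n) +
            ‖z (gridPoint a b n (j + i)) - w (j + i)‖) + δ * valueBound a b K) := by
          gcongr
          refine (norm_sub_le _ _).trans (add_le_add (h1.trans ?_) h2)
          gcongr
          refine h5.trans ?_
          gcongr
          exact h3.trans (by gcongr)
      _ = _ := by ring
  rw [hid k hk]
  have h6 : ‖η - w 0‖ ≤ δ := by rwa [norm_sub_rev]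
  have h7 := hM k hk
  have h8 := norm_sum_le_of_le (Finset.range k) (fun j hj =>
    hterm j (lt_of_lt_of_le (Finset.mem_range.1 hj) hk))
  rw [Finset.sum_add_distrib, Finset.sum_const, Finset.card_range, nsmul_eq_mul,
    ← Finset.mul_sum] at h8
  have h9 : (k : ℝ) * ((b - a) / n * (L * (speedBound a b K * ((b - a) / n)) +
      δ * valueBound a b K)) ≤ (b - a) * (L * (speedBound a b K * ((b - a) / n)) +
      δ * valueBound a b K) := by
    rw [← mul_assoc]
    gcongr
    rw [mul_div_assoc', div_le_iff₀ hn', mul_comm]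
    gcongr
  refine (norm_add₃_le).trans ?_
  linarith

end Schemes

/-! ### A priori bounds for the explicit and implicit values -/

section SchemeBounds

variable {a b : ℝ} {d n : ℕ} {ρ K L δ : ℝ} {R : ℝ≥0∞} {η η' : Vec d} {f g : Field d}
  {z : ℝ → Vec d} {τ : ℕ → ℝ}

theorem node_succ_mem_Icc (hab : a < b) (hn : 1 ≤ n) {j : ℕ} (hj : j < n)
    (hτ : τ (j + 1) ∈ Icc (0 : ℝ) 1) : node a b n τ (j + 1) ∈ Icc a b :=
  ⟨(gridPoint_mem hab hn hj.le).1.trans (node_succ_mem hab hτ).1,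
    (node_succ_mem hab hτ).2.trans (gridPoint_mem hab hn hj).2⟩

theorem IsIVP.norm_noisy_le (h : IsIVP a b ρ K L R η f) (hδ1 : δ ≤ 1)
    (hg : ∀ t ∈ Icc a b, ∀ y, ‖g t y‖ ≤ δ * (1 + ‖y‖)) {t : ℝ} (ht : t ∈ Icc a b) (y : Vec d) :
    ‖f t y + g t y‖ ≤ (K + 1) * (1 + ‖y‖) := by
  have h1 := h.growth t ht y
  have h2 := hg t ht y
  have h3 : δ * (1 + ‖y‖) ≤ 1 * (1 + ‖y‖) := by gcongr
  linarith [norm_add_le (f t y) (g t y)]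

/-- Only linear growth enters: noise of level at most 1 raises the constant to `K + 1`, and `1 + ‖V
j‖` grows by a factor at most `1 + (K + 1) * h` per step. No Lipschitz property is needed, so the
bound can be used to show that the values stay in the ball where `f` is regular. -/
theorem IsIVP.norm_explicitValues_le (hab : a < b) (hn : 1 ≤ n) (hK : 0 < K)
    (h : IsIVP a b ρ K L R η f) (hδ1 : δ ≤ 1)
    (hg : ∀ t ∈ Icc a b, ∀ y, ‖g t y‖ ≤ δ * (1 + ‖y‖)) (hη : ‖η' - η‖ ≤ δ)
    (hτ : ∀ j < n, τ (j + 1) ∈ Icc (0 : ℝ) 1) {j : ℕ} (hj : j ≤ n) :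
    1 + ‖explicitValues ((b - a) / n) (node a b n τ) (η', fun t y => f t y + g t y) j‖ ≤
      (K + 2) * Real.exp ((K + 1) * (b - a)) := by
  have hn' : (0 : ℝ) < n := by positivity
  have hh : 0 < (b - a) / n := div_pos (by linarith) hn'
  set V := explicitValues ((b - a) / n) (node a b n τ) (η', fun t y => f t y + g t y) with hV
  have hstep : ∀ j < n, 1 + ‖V (j + 1)‖ ≤ (1 + (K + 1) * ((b - a) / n)) * (1 + ‖V j‖) := by
    intro j hj
    have e : V (j + 1) = V j + ((b - a) / n) • (f (node a b n τ (j + 1)) (V j) +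
      g (node a b n τ (j + 1)) (V j)) := rfl
    have h1 := h.norm_noisy_le hδ1 hg (node_succ_mem_Icc hab hn hj (hτ j hj)) (V j)
    rw [e]
    refine (add_le_add_right (norm_add_le _ _) 1).trans ?_
    rw [norm_smul, Real.norm_of_nonneg hh.le]
    nlinarith [mul_le_mul_of_nonneg_left h1 hh.le]
  have h0 : 1 + ‖V 0‖ ≤ K + 2 := by
    have e : V 0 = η' := rfl
    rw [e]
    linarith [norm_le_norm_sub_add η' η, h.init_bound]
  have hj' : (j : ℝ) ≤ n := by exact_mod_cast hj
  refine (le_mul_exp_of_succ_le (u := fun j => 1 + ‖V j‖) (by positivity) (by positivity)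
    hstep j hj).trans ?_
  have : (K + 1) * ((b - a) / n) * j ≤ (K + 1) * (b - a) := by
    calc (K + 1) * ((b - a) / n) * j ≤ (K + 1) * ((b - a) / n) * n := by gcongr
      _ = _ := by field_simp
  gcongr

theorem solutionRadius_le_radiusZero (hab : a < b) (hK : 0 < K) :
    solutionRadius a b K ≤ radiusZero a b K := by
  refine le_trans ?_ (le_max_left _ _)
  have hba : 0 < b - a := by linarith
  have : Real.exp (K * (b - a)) ≤ Real.exp ((K + 1) * (b - a)) := by gcongr; linarith
  have h0 : 0 < Real.exp (K * (b - a)) := Real.exp_pos _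
  rw [solutionRadius, radiusOne]
  nlinarith

/-- The error of the randomized explicit Euler scheme along a path. -/
theorem IsIVP.norm_solution_sub_explicitEuler_le (hab : a < b) (hn : 1 ≤ n) (hK : 0 < K)
    (hL : 0 < L) (h : IsIVP a b ρ K L (ENNReal.ofReal (radiusZero a b K)) η f)
    (hz : IsSolution a b (η, f) z) (hδ : 0 ≤ δ) (hδ1 : δ ≤ 1)
    (hstep : L * ((b - a) / n) ≤ 1 / 2)
    (hg : ∀ t ∈ Icc a b, ∀ y, ‖g t y‖ ≤ δ * (1 + ‖y‖)) (hη : ‖η' - η‖ ≤ δ)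
    (hτ : ∀ j < n, τ (j + 1) ∈ Icc (0 : ℝ) 1) {M : ℝ}
    (hM : ∀ k ≤ n, ‖quadratureError a b n f z (node a b n τ) k‖ ≤ M) {t : ℝ}
    (ht : t ∈ Icc a b) :
    ‖z t - explicitEuler a b n τ (η', fun t y => f t y + g t y) t‖ ≤
      pathBound a b K L M ((b - a) / n) δ := by
  have hb := fun j (hj : j ≤ n) => h.norm_explicitValues_le hab hn hK hδ1 hg hη hτ hj
  rw [explicitEuler]
  obtain ⟨V, hV⟩ : ∃ V, V = explicitValues ((b - a) / n) (node a b n τ)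
    (η', fun t y => f t y + g t y) := ⟨_, rfl⟩
  have hV0 : V 0 = η' := by rw [hV]; rfl
  have hVs : ∀ j < n, V (j + 1) = V j + ((b - a) / n) • (f (node a b n τ (j + 1)) (V (j + 0)) +
      g (node a b n τ (j + 1)) (V (j + 0))) := fun j _ => by rw [hV]; rfl
  rw [← hV] at hb ⊢
  refine h.norm_solution_sub_interpolate_le hab hn hK hL
    (ENNReal.ofReal_le_ofReal (solutionRadius_le_radiusZero hab hK)) hz hδ hstep zero_le_one hg
    (fun j hj => node_succ_mem hab (hτ j hj)) (by rwa [hV0]) hVs ?_ ?_ hM ht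
  -- The distance to `η` is at most the growth bound minus 1, plus `K`, which is exactly
  -- `radiusOne`.
  · intro j hj
    have h1 := hb j hj.le
    rw [← ofReal_norm]
    refine ENNReal.ofReal_le_ofReal ?_
    refine le_trans ?_ (le_max_left _ _)
    refine (norm_sub_le _ _).trans ?_
    rw [radiusOne]
    have := h.init_bound
    rw [add_zero]
    linarith
  · intro j hj
    refine (hb j hj).trans ?_
    have hba : 0 < b - a := by linarith
    rw [valueBound]
    gcongr
    linarith

/-- The step map is a contraction with factor 1/2, so Banach's theorem supplies a fixed point and
the choice in the definition satisfies its equation. The contraction acts on the whole space, hence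
`R = ∞` and Lipschitz noise. -/
theorem IsIVP.implicitValues_succ (hab : a < b) (hn : 1 ≤ n)
    (h : IsIVP a b ρ K L ∞ η f) (hδ1 : δ ≤ 1) (hstep : (L + 1) * ((b - a) / n) ≤ 1 / 2)
    (hg : ∀ t ∈ Icc a b, ∀ x y, ‖g t x - g t y‖ ≤ δ * ‖x - y‖)
    (hτ : ∀ j < n, τ (j + 1) ∈ Icc (0 : ℝ) 1) {j : ℕ} (hj : j < n) {U : ℕ → Vec d}
    (hU : U = implicitValues ((b - a) / n) (node a b n τ) (η', fun t y => f t y + g t y)) :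
    U (j + 1) = U j + ((b - a) / n) • (f (node a b n τ (j + 1)) (U (j + 1)) +
      g (node a b n τ (j + 1)) (U (j + 1))) := by
  have hn' : (0 : ℝ) < n := by positivity
  have hh : 0 < (b - a) / n := div_pos (by linarith) hn'
  have hθ := node_succ_mem_Icc hab hn hj (hτ j hj)
  have hc : ContractingWith (1 / 2) (fun x : Vec d => U j + ((b - a) / n) •
      (f (node a b n τ (j + 1)) x + g (node a b n τ (j + 1)) x)) := by
    refine ⟨by rw [← NNReal.coe_lt_coe]; norm_num, LipschitzWith.of_dist_le_mul fun x y => ?_⟩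
    have h1 := h.lipschitz_space _ hθ x y le_top le_top
    have h2 := hg _ hθ x y
    rw [dist_eq_norm, dist_eq_norm, add_sub_add_left_eq_sub, ← smul_sub, norm_smul,
      Real.norm_of_nonneg hh.le, add_sub_add_comm]
    have h3 := norm_add_le (f (node a b n τ (j + 1)) x - f (node a b n τ (j + 1)) y)
      (g (node a b n τ (j + 1)) x - g (node a b n τ (j + 1)) y)
    have h4 : δ * ‖x - y‖ ≤ 1 * ‖x - y‖ := by gcongr
    calc (b - a) / n * _ ≤ (b - a) / n * ((L + 1) * ‖x - y‖) := by gcongr; linarith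
      _ = (L + 1) * ((b - a) / n) * ‖x - y‖ := by ring
      _ ≤ 1 / 2 * ‖x - y‖ := by gcongr
      _ = _ := by norm_num
  have := Classical.epsilon_spec (p := fun x : Vec d => x = U j + ((b - a) / n) •
      (f (node a b n τ (j + 1)) x + g (node a b n τ (j + 1)) x))
    ⟨hc.fixedPoint, hc.fixedPoint_isFixedPt.symm⟩
  subst hU
  exact this

/-- With `x = (K + 1) * h ≤ 1/2`, solving for the new value costs a factor `1 / (1 - x) ≤ 1 + 2 *
x`; this is the origin of the 2 in the exponent of `valueBound`. -/
theorem norm_implicitValues_le (hab : a < b) (hn : 1 ≤ n) (hK : 0 < K)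
    (h : IsIVP a b ρ K L R η f) (hδ1 : δ ≤ 1) (hstep : (K + 1) * ((b - a) / n) ≤ 1 / 2)
    (hg : ∀ t ∈ Icc a b, ∀ y, ‖g t y‖ ≤ δ * (1 + ‖y‖))
    (hτ : ∀ j < n, τ (j + 1) ∈ Icc (0 : ℝ) 1) {U : ℕ → Vec d} (hU0 : ‖U 0 - η‖ ≤ δ)
    (hU : ∀ j < n, U (j + 1) = U j + ((b - a) / n) • (f (node a b n τ (j + 1)) (U (j + 1)) +
      g (node a b n τ (j + 1)) (U (j + 1)))) {j : ℕ} (hj : j ≤ n) :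
    1 + ‖U j‖ ≤ valueBound a b K := by
  have hn' : (0 : ℝ) < n := by positivity
  have hh : 0 < (b - a) / n := div_pos (by linarith) hn'
  have hs : ∀ j < n, 1 + ‖U (j + 1)‖ ≤ (1 + 2 * (K + 1) * ((b - a) / n)) * (1 + ‖U j‖) := by
    intro j hj
    have h1 := h.norm_noisy_le hδ1 hg (node_succ_mem_Icc hab hn hj (hτ j hj)) (U (j + 1))
    have h2 : ‖U (j + 1)‖ ≤ ‖U j‖ + (b - a) / n * ((K + 1) * (1 + ‖U (j + 1)‖)) := by
      calc ‖U (j + 1)‖ = ‖U j + ((b - a) / n) • (f (node a b n τ (j + 1)) (U (j + 1)) +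
            g (node a b n τ (j + 1)) (U (j + 1)))‖ := by rw [← hU j hj]
        _ ≤ _ := by
          refine (norm_add_le _ _).trans ?_
          rw [norm_smul, Real.norm_of_nonneg hh.le]
          gcongr
    set x := (K + 1) * ((b - a) / n) with hx
    have hx0 : 0 ≤ x := by positivity
    have h3 : (1 + ‖U (j + 1)‖) * (1 - x) ≤ 1 + ‖U j‖ := by rw [hx]; linarith
    have h4 : 1 ≤ (1 + 2 * x) * (1 - x) := by nlinarith
    calc 1 + ‖U (j + 1)‖ ≤ (1 + ‖U (j + 1)‖) * ((1 + 2 * x) * (1 - x)) :=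
          le_mul_of_one_le_right (by positivity) h4
      _ = (1 + 2 * x) * ((1 + ‖U (j + 1)‖) * (1 - x)) := by ring
      _ ≤ (1 + 2 * x) * (1 + ‖U j‖) := by gcongr
      _ = _ := by rw [hx]; ring
  have h0 : 1 + ‖U 0‖ ≤ K + 2 := by
    linarith [norm_le_norm_sub_add (U 0) η, h.init_bound]
  have hj' : (j : ℝ) ≤ n := by exact_mod_cast hj
  refine (le_mul_exp_of_succ_le (u := fun j => 1 + ‖U j‖) (by positivity) (by positivity)
    hs j hj).trans ?_
  have : 2 * (K + 1) * ((b - a) / n) * j ≤ 2 * (K + 1) * (b - a) := by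
    calc 2 * (K + 1) * ((b - a) / n) * j ≤ 2 * (K + 1) * ((b - a) / n) * n := by gcongr
      _ = _ := by field_simp
  rw [valueBound]
  gcongr

/-- The error of the randomized implicit Euler scheme along a path. -/
theorem IsIVP.norm_solution_sub_implicitEuler_le (hab : a < b) (hn : 1 ≤ n) (hK : 0 < K)
    (hL : 0 < L) (h : IsIVP a b ρ K L ∞ η f)
    (hz : IsSolution a b (η, f) z) (hδ : 0 ≤ δ) (hδ1 : δ ≤ 1)
    (hstep : (L + 1) * ((b - a) / n) ≤ 1 / 2) (hstep' : (K + 1) * ((b - a) / n) ≤ 1 / 2)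
    (hg : ∀ t ∈ Icc a b, ∀ y, ‖g t y‖ ≤ δ * (1 + ‖y‖))
    (hg' : ∀ t ∈ Icc a b, ∀ x y, ‖g t x - g t y‖ ≤ δ * ‖x - y‖) (hη : ‖η' - η‖ ≤ δ)
    (hτ : ∀ j < n, τ (j + 1) ∈ Icc (0 : ℝ) 1) {M : ℝ}
    (hM : ∀ k ≤ n, ‖quadratureError a b n f z (node a b n τ) k‖ ≤ M) {t : ℝ}
    (ht : t ∈ Icc a b) :
    ‖z t - implicitEuler a b n τ (η', fun t y => f t y + g t y) t‖ ≤
      pathBound a b K L M ((b - a) / n) δ := by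
  rw [implicitEuler]
  obtain ⟨U, hUdef⟩ : ∃ U, U = implicitValues ((b - a) / n) (node a b n τ)
    (η', fun t y => f t y + g t y) := ⟨_, rfl⟩
  have hU := fun j (hj : j < n) =>
    h.implicitValues_succ hab hn hδ1 hstep hg' hτ hj hUdef
  have hU0 : ‖U 0 - η‖ ≤ δ := by rw [hUdef]; exact hη
  rw [← hUdef]
  have hh : 0 ≤ (b - a) / n := div_nonneg (by linarith) (by positivity)
  exact h.norm_solution_sub_interpolate_le hab hn hK hL le_top hz hδ (by linarith) le_rfl hg
    (fun j hj => node_succ_mem hab (hτ j hj)) hU0 hU (fun _ _ => le_top)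
    (fun j hj => norm_implicitValues_le hab hn hK h hδ1 hstep' hg hτ hU0 hU hj) hM ht

end SchemeBounds

/-! ### Even moments of sub-Gaussian variables and of their maxima -/

section Moments

/-- The pointwise `ℓ^{2m}` norm of a finite family of random variables. -/
def powerMax {Ω ι : Type*} [Fintype ι] (S : ι → Ω → ℝ) (m : ℕ) (ω : Ω) : ℝ :=
  (∑ i, S i ω ^ (2 * m)) ^ (((2 * m : ℕ) : ℝ)⁻¹)

theorem abs_le_powerMax {Ω ι : Type*} [Fintype ι] (S : ι → Ω → ℝ) {m : ℕ} (hm : 1 ≤ m) (i : ι)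
    (ω : Ω) : |S i ω| ≤ powerMax S m ω := by
  have h1 : |S i ω| ^ (2 * m) ≤ ∑ i, S i ω ^ (2 * m) := by
    rw [(even_two_mul m).pow_abs]
    exact Finset.single_le_sum (f := fun i => S i ω ^ (2 * m))
      (fun i _ => (even_two_mul m).pow_nonneg _) (Finset.mem_univ i)
  calc |S i ω| = (|S i ω| ^ (2 * m)) ^ (((2 * m : ℕ) : ℝ)⁻¹) :=
        (Real.pow_rpow_inv_natCast (abs_nonneg _) (by omega)).symm
    _ ≤ _ := by
        unfold powerMax
        gcongr

variable {Ω : Type*} [MeasurableSpace Ω] {P : Measure Ω}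

/-- From `|x| ^ (2 * m) ≤ (2 * m)! * exp |x|` at `x = l * S` with `l = 1 / √σ`; at `±l` the moment
generating function is at most `exp (1 / 2) ≤ 2`. -/
theorem lintegral_pow_le_of_hasSubgaussianMGF {S : Ω → ℝ} {c : NNReal} {σ : ℝ}
    (hS : HasSubgaussianMGF S c P) (hσ : 0 < σ) (hcσ : c ≤ σ) (m : ℕ) :
    ∫⁻ ω, ENNReal.ofReal (S ω ^ (2 * m)) ∂P ≤
      ENNReal.ofReal (4 * (2 * m).factorial * σ ^ m) := by
  obtain ⟨l, hl0, hl⟩ : ∃ l : ℝ, 0 < l ∧ l ^ 2 * σ = 1 := by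
    refine ⟨(√σ)⁻¹, by positivity, ?_⟩
    rw [inv_pow, Real.sq_sqrt hσ.le, inv_mul_cancel₀ hσ.ne']
  have hpt : ∀ ω, S ω ^ (2 * m) ≤ (2 * m).factorial * σ ^ m *
      (Real.exp (l * S ω) + Real.exp (-l * S ω)) := by
    intro ω
    have h1 := Real.pow_div_factorial_le_exp _ (abs_nonneg (l * S ω)) (2 * m)
    have h2 : Real.exp |l * S ω| ≤ Real.exp (l * S ω) + Real.exp (-l * S ω) := by
      rcases abs_choice (l * S ω) with h | h <;> rw [h]
      · linarith [Real.exp_pos (-l * S ω)]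
      · rw [neg_mul]; linarith [Real.exp_pos (l * S ω)]
    rw [(even_two_mul m).pow_abs, div_le_iff₀ (by positivity)] at h1
    have h3 : S ω ^ (2 * m) = σ ^ m * (l * S ω) ^ (2 * m) := by
      calc S ω ^ (2 * m) = (l ^ 2 * σ) ^ m * S ω ^ (2 * m) := by rw [hl, one_pow, one_mul]
        _ = _ := by rw [mul_pow, mul_pow, ← pow_mul]; ring
    rw [h3]
    calc σ ^ m * (l * S ω) ^ (2 * m)
        ≤ σ ^ m * ((Real.exp (l * S ω) + Real.exp (-l * S ω)) * (2 * m).factorial) := by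
          gcongr
          exact h1.trans (by gcongr)
      _ = _ := by ring
  have hi1 := hS.integrable_exp_mul l
  have hi2 := hS.integrable_exp_mul (-l)
  have hm : ∀ l' : ℝ, l' ^ 2 * σ = 1 → ∫ ω, Real.exp (l' * S ω) ∂P ≤ 2 := by
    intro l' hl'
    refine (hS.mgf_le l').trans ?_
    have h1 : (c : ℝ) * l' ^ 2 / 2 ≤ 1 / 2 := by
      have := mul_le_mul_of_nonneg_left hcσ (sq_nonneg l')
      linarith
    refine (Real.exp_le_exp.2 h1).trans ?_
    have h2 : Real.exp (1 / 2) * Real.exp (1 / 2) = Real.exp 1 := by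
      rw [← Real.exp_add]; norm_num
    nlinarith [Real.exp_one_lt_d9, Real.exp_pos (1 / 2)]
  calc ∫⁻ ω, ENNReal.ofReal (S ω ^ (2 * m)) ∂P
      ≤ ∫⁻ ω, ENNReal.ofReal ((2 * m).factorial * σ ^ m *
          (Real.exp (l * S ω) + Real.exp (-l * S ω))) ∂P :=
        lintegral_mono fun ω => ENNReal.ofReal_le_ofReal (hpt ω)
    _ = ENNReal.ofReal (∫ ω, (2 * m).factorial * σ ^ m *
          (Real.exp (l * S ω) + Real.exp (-l * S ω)) ∂P) := by
        rw [ofReal_integral_eq_lintegral_ofReal]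
        · exact (hi1.add hi2).const_mul _
        · exact Filter.Eventually.of_forall fun ω => by positivity
    _ ≤ _ := by
        apply ENNReal.ofReal_le_ofReal
        rw [integral_const_mul, integral_add hi1 hi2]
        have h1 := hm l hl
        have h2 := hm (-l) (by rwa [neg_sq])
        calc (2 * m).factorial * σ ^ m * _ ≤ (2 * m).factorial * σ ^ m * 4 := by
              gcongr
              linarith
          _ = _ := by ring

/-- The 2m-th power of the majorant is a plain sum, so bounding the maximum costs only the number of
variables inside the 2m-th moment. -/
theorem eLpNorm_powerMax_le {ι : Type*} [Fintype ι] {S : ι → Ω → ℝ} {m : ℕ} (hm : 1 ≤ m)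
    (hS : ∀ i, AEMeasurable (S i) P) {D A : ℝ}
    (hD : ∀ i, ∫⁻ ω, ENNReal.ofReal (S i ω ^ (2 * m)) ∂P ≤ ENNReal.ofReal D) (hA : 0 ≤ A)
    (hDA : Fintype.card ι * D ≤ A ^ (2 * m)) :
    eLpNorm (powerMax S m) ((2 * m : ℕ) : ℝ≥0∞) P ≤ ENNReal.ofReal A := by
  have hm0 : ((2 * m : ℕ) : ℝ≥0∞) ≠ 0 := by
    rw [Nat.cast_ne_zero]; omega
  have hnn : ∀ ω, 0 ≤ ∑ i, S i ω ^ (2 * m) := fun ω =>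
    Finset.sum_nonneg fun i _ => (even_two_mul m).pow_nonneg _
  rw [eLpNorm_eq_lintegral_rpow_enorm_toReal hm0 (ENNReal.natCast_ne_top _), ENNReal.toReal_natCast,
    one_div, ENNReal.rpow_inv_le_iff (by positivity)]
  have he : ∀ ω, ‖powerMax S m ω‖ₑ ^ ((2 * m : ℕ) : ℝ) =
      ∑ i, ENNReal.ofReal (S i ω ^ (2 * m)) := by
    intro ω
    rw [powerMax, Real.enorm_of_nonneg (Real.rpow_nonneg (hnn ω) _), ENNReal.rpow_natCast,
      ← ENNReal.ofReal_pow (Real.rpow_nonneg (hnn ω) _),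
      Real.rpow_inv_natCast_pow (hnn ω) (by omega), ENNReal.ofReal_sum_of_nonneg]
    exact fun i _ => (even_two_mul m).pow_nonneg _
  simp_rw [he]
  rw [lintegral_finsetSum' _ fun i _ => ((hS i).pow_const _).ennreal_ofReal]
  calc ∑ i, ∫⁻ ω, ENNReal.ofReal (S i ω ^ (2 * m)) ∂P ≤ ∑ _i : ι, ENNReal.ofReal D :=
        Finset.sum_le_sum fun i _ => hD i
    _ = ENNReal.ofReal (Fintype.card ι * D) := by
        rw [Finset.sum_const, Finset.card_univ, nsmul_eq_mul,
          ENNReal.ofReal_mul (Nat.cast_nonneg _), ENNReal.ofReal_natCast]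
    _ ≤ ENNReal.ofReal (A ^ (2 * m)) := ENNReal.ofReal_le_ofReal hDA
    _ = _ := by rw [ENNReal.rpow_natCast, ENNReal.ofReal_pow hA]

theorem aemeasurable_powerMax {ι : Type*} [Fintype ι] {S : ι → Ω → ℝ} {m : ℕ}
    (hS : ∀ i, AEMeasurable (S i) P) : AEMeasurable (powerMax S m) P := by
  unfold powerMax
  exact (Finset.aemeasurable_fun_sum _ fun i _ => (hS i).pow_const _).pow_const _

end Moments

/-! ### Independent uniform samples and Hoeffding's lemma -/

section UniformSample

variable {Ω : Type*} [MeasurableSpace Ω] {P : Measure Ω} {n : ℕ} {τ : ℕ → Ω → ℝ}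

theorem IsUniformSample.map_eq (h : IsUniformSample P n τ) {j : ℕ} (hj : j < n) :
    P.map (τ (j + 1)) = volume.restrict (Ioo (0 : ℝ) 1) := by
  have := h.unif (j + 1) ⟨by omega, by omega⟩
  rw [pdf.IsUniform, ProbabilityTheory.cond] at this
  rw [this]
  simp

theorem IsUniformSample.measurable_succ (h : IsUniformSample P n τ) {j : ℕ} (hj : j < n) :
    Measurable (τ (j + 1)) := h.meas (j + 1) ⟨by omega, by omega⟩

theorem IsUniformSample.ae_mem (h : IsUniformSample P n τ) :
    ∀ᵐ ω ∂P, ∀ j < n, τ (j + 1) ω ∈ Ioo (0 : ℝ) 1 := by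
  rw [ae_all_iff]
  intro j
  by_cases hj : j < n
  · have : ∀ᵐ u ∂(P.map (τ (j + 1))), u ∈ Ioo (0 : ℝ) 1 := by
      rw [h.map_eq hj]
      exact ae_restrict_mem measurableSet_Ioo
    filter_upwards [ae_of_ae_map (h.measurable_succ hj).aemeasurable this] with ω hω _
    exact hω
  · exact Filter.Eventually.of_forall fun ω h => absurd h hj

theorem IsUniformSample.integral_comp (h : IsUniformSample P n τ) {j : ℕ} (hj : j < n)
    {G : ℝ → ℝ} (hG : Measurable G) : ∫ ω, G (τ (j + 1) ω) ∂P = ∫ u in (0 : ℝ)..1, G u := by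
  rw [← integral_map (h.measurable_succ hj).aemeasurable hG.aestronglyMeasurable, h.map_eq hj,
    intervalIntegral.integral_of_le zero_le_one, integral_Ioc_eq_integral_Ioo]

/-- A sum of independent, centred and bounded functions of the sample is sub-Gaussian. -/
theorem IsUniformSample.hasSubgaussianMGF_sum [IsProbabilityMeasure P]
    (h : IsUniformSample P n τ) {k : ℕ} (hk : k ≤ n) {G : ℕ → ℝ → ℝ} (hG : ∀ j, Measurable (G j))
    {B : NNReal} (hB : ∀ j < n, ∀ u ∈ Ioo (0 : ℝ) 1, |G j u| ≤ B)
    (h0 : ∀ j < n, ∫ u in (0 : ℝ)..1, G j u = 0) :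
    HasSubgaussianMGF (fun ω => ∑ j ∈ Finset.range k, G j (τ (j + 1) ω)) (k * B ^ 2) P := by
  have hind : iIndepFun (fun j : Fin k => G j ∘ τ (j + 1)) P := by
    -- Samples are numbered from 1 and summands from 0.
    let e : Fin k → Icc 1 n := fun j => ⟨j + 1, by constructor <;> omega⟩
    have he : Function.Injective e := fun i j hij => by
      have : (i : ℕ) + 1 = j + 1 := congrArg Subtype.val hij
      exact Fin.ext (by omega)
    exact (h.indep.precomp he).comp (fun j => G j) (fun j => hG j)
  have hsub : ∀ j ∈ (Finset.univ : Finset (Fin k)),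
      HasSubgaussianMGF (G j ∘ τ (j + 1)) (B ^ 2) P := by
    intro j _
    have hj : (j : ℕ) < n := j.2.trans_le hk
    -- Hoeffding's lemma on `[-B, B]`: half the length is `B`, so the variance proxy is `B ^ 2`.
    have h1 := hasSubgaussianMGF_of_mem_Icc_of_integral_eq_zero (μ := P)
      (X := G j ∘ τ (j + 1)) (a := -B) (b := B)
      ((hG j).comp (h.measurable_succ hj)).aemeasurable ?_ ?_
    · have h2 : ‖(B : ℝ) - -B‖₊ / 2 = B := by
        rw [← NNReal.coe_inj]
        push_cast
        rw [sub_neg_eq_add, Real.norm_of_nonneg (by positivity)]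
        ring
      rwa [h2] at h1
    · filter_upwards [h.ae_mem] with ω hω
      exact abs_le.1 (hB j hj _ (hω j hj))
    · exact (h.integral_comp hj (hG j)).trans (h0 j hj)
  have := HasSubgaussianMGF.sum_of_iIndepFun hind hsub
  simp only [Finset.sum_const, Finset.card_univ, Fintype.card_fin, nsmul_eq_mul] at this
  refine this.congr (Filter.Eventually.of_forall fun ω => ?_)
  simp only [Finset.sum_range, Function.comp]

end UniformSample

/-! ### The randomized quadrature error -/

section QuadratureError

variable {a b : ℝ} {d n : ℕ} {ρ K L : ℝ} {R : ℝ≥0∞} {η : Vec d} {f : Field d} {z : ℝ → Vec d}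

theorem abs_apply_le_norm (x : Vec d) (i : Fin d) : |x i| ≤ ‖x‖ := by
  simpa using PiLp.norm_apply_le x i

theorem norm_le_card_mul {x : Vec d} {T : ℝ} (h : ∀ i, |x i| ≤ T) : ‖x‖ ≤ d * T := by
  have : ‖x‖ = ∑ i, ‖x i‖ := by simpa using PiLp.norm_eq_sum (p := 1) (by norm_num) x
  rw [this]
  calc ∑ i, ‖x i‖ ≤ ∑ _i : Fin d, T := Finset.sum_le_sum fun i _ => h i
    _ = d * T := by simp

/-- The `i`-th coordinate of `f (s, z s)`, extended from `[a,b]` to all times. -/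
def slopeCoord (hab : a < b) (f : Field d) (z : ℝ → Vec d) (i : Fin d) (s : ℝ) : ℝ :=
  IccExtend hab.le (fun t : Icc a b => f t (z t) i) s

theorem slopeCoord_of_mem (hab : a < b) (f : Field d) (z : ℝ → Vec d) (i : Fin d) {s : ℝ}
    (hs : s ∈ Icc a b) : slopeCoord hab f z i s = f s (z s) i :=
  IccExtend_of_mem hab.le _ hs

theorem IsIVP.continuous_slopeCoord (hab : a < b) (h : IsIVP a b ρ K L R η f)
    (hz : IsSolution a b (η, f) z) (i : Fin d) : Continuous (slopeCoord hab f z i) := by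
  refine Continuous.Icc_extend' ?_
  have := h.continuousOn_comp hz.continuousOn
  exact (PiLp.continuous_apply 1 _ i).comp (continuousOn_iff_continuous_domRestrict.1 this)

/-- One coordinate of the error of one step of the randomized quadrature rule, as a function of
the random offset. -/
def stepError (hab : a < b) (n : ℕ) (f : Field d) (z : ℝ → Vec d) (i : Fin d) (j : ℕ) (u : ℝ) :
    ℝ :=
  z (gridPoint a b n (j + 1)) i - z (gridPoint a b n j) i -
    (b - a) / n * slopeCoord hab f z i (gridPoint a b n j + u * ((b - a) / n))

/-- Because `slopeCoord` extends the slope continuously to all times, continuity holds on all of ℝ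
and yields the measurability needed to compose with the samples. -/
theorem IsIVP.continuous_stepError (hab : a < b) (h : IsIVP a b ρ K L R η f)
    (hz : IsSolution a b (η, f) z) (i : Fin d) (j : ℕ) :
    Continuous (stepError hab n f z i j) := by
  have := h.continuous_slopeCoord hab hz i
  unfold stepError
  fun_prop

theorem offset_mem (hab : a < b) {j : ℕ} {u : ℝ} (hu : u ∈ Icc (0 : ℝ) 1) :
    gridPoint a b n j + u * ((b - a) / n) ∈
      Icc (gridPoint a b n j) (gridPoint a b n j + (b - a) / n) := by
  have h0 : 0 ≤ (b - a) / n := div_nonneg (by linarith) (by positivity)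
  constructor
  · nlinarith [mul_nonneg hu.1 h0]
  · nlinarith [mul_le_mul_of_nonneg_right hu.2 h0]

theorem offset_mem_Icc (hab : a < b) (hn : 1 ≤ n) {j : ℕ} (hj : j < n) {u : ℝ}
    (hu : u ∈ Icc (0 : ℝ) 1) : gridPoint a b n j + u * ((b - a) / n) ∈ Icc a b := by
  have h1 := offset_mem (n := n) hab (j := j) hu
  have h2 := gridPoint_mem hab hn hj
  rw [gridPoint_succ] at h2
  exact ⟨(gridPoint_mem hab hn hj.le).1.trans h1.1, h1.2.trans h2.2⟩

theorem stepError_eq (hab : a < b) (hn : 1 ≤ n) (i : Fin d) {j : ℕ} (hj : j < n) {u : ℝ}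
    (hu : u ∈ Icc (0 : ℝ) 1) :
    stepError hab n f z i j u = (z (gridPoint a b n (j + 1)) - z (gridPoint a b n j) -
      ((b - a) / n) • f (gridPoint a b n j + u * ((b - a) / n))
        (z (gridPoint a b n j + u * ((b - a) / n)))) i := by
  rw [stepError, slopeCoord_of_mem hab f z i (offset_mem_Icc hab hn hj hu)]
  simp

theorem IsIVP.abs_stepError_le (hab : a < b) (hn : 1 ≤ n) (hK : 0 < K) (hL : 0 < L) (hρ : 0 < ρ)
    (hρ1 : ρ ≤ 1) (hR : ENNReal.ofReal (solutionRadius a b K) ≤ R) (h : IsIVP a b ρ K L R η f)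
    (hz : IsSolution a b (η, f) z) (hstep : (b - a) / n ≤ 1) (i : Fin d) {j : ℕ} (hj : j < n)
    {u : ℝ} (hu : u ∈ Icc (0 : ℝ) 1) :
    |stepError hab n f z i j u| ≤
      slopeConst a b K L * ((b - a) / n) ^ ρ * ((b - a) / n) := by
  rw [stepError_eq hab hn i hj hu]
  refine (abs_apply_le_norm _ i).trans ?_
  have h2 := gridPoint_mem hab hn hj
  rw [gridPoint_succ] at h2 ⊢
  exact h.norm_step_remainder_le hK hL hρ hρ1 hR hz (gridPoint_mem hab hn hj.le).1 h2.2
    (div_nonneg (by linarith) (by positivity)) hstep (offset_mem hab hu)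

/-- Unbiasedness: after the substitution `t = t_j + u * h`, the mean of `h * f θ (z θ)` is the
integral of `z'` over the step, which equals the increment of `z`. -/
theorem IsIVP.integral_stepError (hab : a < b) (hn : 1 ≤ n) (h : IsIVP a b ρ K L R η f)
    (hz : IsSolution a b (η, f) z) (i : Fin d) {j : ℕ} (hj : j < n) :
    ∫ u in (0 : ℝ)..1, stepError hab n f z i j u = 0 := by
  have hn' : (0 : ℝ) < n := by positivity
  have hh : 0 < (b - a) / n := div_pos (by linarith) hn'
  have hc := h.continuous_slopeCoord hab hz i
  have key : ∫ u in (0 : ℝ)..1,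
      (b - a) / n * slopeCoord hab f z i (gridPoint a b n j + u * ((b - a) / n)) =
      z (gridPoint a b n (j + 1)) i - z (gridPoint a b n j) i := by
    have h1 := intervalIntegral.integral_eq_sub_of_hasDerivAt_of_le (a := (0 : ℝ)) (b := 1)
      (f := fun u => z (gridPoint a b n j + u * ((b - a) / n)) i)
      (f' := fun u => (b - a) / n *
        slopeCoord hab f z i (gridPoint a b n j + u * ((b - a) / n))) zero_le_one ?_ ?_ ?_
    · rw [h1, one_mul, zero_mul, add_zero, gridPoint_succ]
    · exact (PiLp.continuous_apply 1 _ i).comp_continuousOn (hz.continuousOn.comp (by fun_prop)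
        (fun u hu => offset_mem_Icc hab hn hj hu))
    · intro u hu
      have hm := offset_mem_Icc hab hn hj (Ioo_subset_Icc_self hu)
      have hlt : gridPoint a b n j + u * ((b - a) / n) ∈ Ioo a b := by
        have h2 := gridPoint_mem hab hn hj
        have h3 := gridPoint_mem hab hn hj.le
        rw [gridPoint_succ] at h2
        constructor
        · nlinarith [mul_pos hu.1 hh, h3.1]
        · nlinarith [mul_lt_mul_of_pos_right hu.2 hh, h2.2]
      have hd := (hz.2 _ hm).hasDerivAt (Icc_mem_nhds hlt.1 hlt.2)
      have hd2 : HasDerivAt (fun u : ℝ => gridPoint a b n j + u * ((b - a) / n))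
          ((b - a) / n) u := by
        simpa using ((hasDerivAt_id u).mul_const ((b - a) / n)).const_add (gridPoint a b n j)
      have hd3 := HasDerivAt.scomp u hd hd2
      have hd4 := (PiLp.proj 1 (fun _ : Fin d => ℝ) i : Vec d →L[ℝ] ℝ).hasFDerivAt.comp_hasDerivAt
        u hd3
      rw [slopeCoord_of_mem hab f z i hm]
      rwa [map_smul] at hd4
    · exact Continuous.intervalIntegrable (by fun_prop) _ _
  simp only [stepError]
  rw [intervalIntegral.integral_sub, key]
  · simp
  · exact intervalIntegrable_const
  · exact Continuous.intervalIntegrable (by fun_prop) _ _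

/-- Each variance proxy is of order n^(-1-2ρ), with m-th power n^(-(1+2ρ)m), and the number of
variables adds one factor n. The total is at most n^(-2m) precisely because `1 ≤ (2 * ρ - 1) * m`.
-/
theorem moment_bound {ρ β : ℝ} {m d n : ℕ} (hd : 1 ≤ d) (hn : 1 ≤ n)
    (hβ : 0 ≤ β) (hm : 1 ≤ (2 * ρ - 1) * m) :
    ((d * (n + 1) : ℕ) : ℝ) * (4 * (2 * m).factorial * (n * (β * (n : ℝ) ^ (-(ρ + 1))) ^ 2) ^ m) ≤
      (8 * d * (2 * m).factorial * β / n) ^ (2 * m) := by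
  have hn' : (0 : ℝ) < n := by positivity
  have hn1 : (1 : ℝ) ≤ n := by exact_mod_cast hn
  have hd1 : (1 : ℝ) ≤ d := by exact_mod_cast hd
  have hf1 : (1 : ℝ) ≤ (2 * m).factorial := by exact_mod_cast Nat.factorial_pos _
  have hm0 : m ≠ 0 := by rintro rfl; norm_num at hm
  set D : ℝ := 8 * d * (2 * m).factorial with hD
  have hD1 : 1 ≤ D := by nlinarith
  have e1 : (n * (β * (n : ℝ) ^ (-(ρ + 1))) ^ 2) ^ m =
      β ^ (2 * m) * (n : ℝ) ^ (-((1 + 2 * ρ) * m)) := by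
    have : (n : ℝ) * (β * (n : ℝ) ^ (-(ρ + 1))) ^ 2 = β ^ 2 * (n : ℝ) ^ (-(1 + 2 * ρ)) := by
      rw [mul_pow, ← Real.rpow_natCast ((n : ℝ) ^ (-(ρ + 1))), ← Real.rpow_mul hn'.le]
      have : (n : ℝ) ^ (-(1 + 2 * ρ)) = n * (n : ℝ) ^ (-(ρ + 1) * ((2 : ℕ) : ℝ)) := by
        rw [← Real.rpow_one_add' hn'.le]
        · congr 1; push_cast; ring
        · push_cast
          intro h0
          have : ρ = - (1 / 2) := by linarith
          subst this
          have : (0 : ℝ) ≤ m := Nat.cast_nonneg _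
          nlinarith
      rw [this]; ring
    rw [this, mul_pow, ← pow_mul, ← Real.rpow_natCast ((n : ℝ) ^ (-(1 + 2 * ρ))),
      ← Real.rpow_mul hn'.le]
    congr 2; ring
  have e2 : (n : ℝ) * (n : ℝ) ^ (-((1 + 2 * ρ) * m)) ≤ ((n : ℝ) ^ (2 * m))⁻¹ := by
    rw [← Real.rpow_natCast, ← Real.rpow_neg hn'.le]
    nth_rewrite 1 [← Real.rpow_one (n : ℝ)]
    rw [← Real.rpow_add hn']
    apply Real.rpow_le_rpow_of_exponent_le hn1
    push_cast
    nlinarith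
  rw [e1, div_pow, mul_pow]
  have e3 : D ≤ D ^ (2 * m) := le_self_pow₀ hD1 (by omega)
  have hβ2 : 0 ≤ β ^ (2 * m) := by positivity
  calc ((d * (n + 1) : ℕ) : ℝ) * (4 * (2 * m).factorial *
        (β ^ (2 * m) * (n : ℝ) ^ (-((1 + 2 * ρ) * m))))
      ≤ (d * (2 * n)) * (4 * (2 * m).factorial *
        (β ^ (2 * m) * (n : ℝ) ^ (-((1 + 2 * ρ) * m)))) := by
        gcongr
        push_cast
        gcongr
        linarith
    _ = D * β ^ (2 * m) * (n * (n : ℝ) ^ (-((1 + 2 * ρ) * m))) := by rw [hD]; ring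
    _ ≤ D ^ (2 * m) * β ^ (2 * m) * ((n : ℝ) ^ (2 * m))⁻¹ := by gcongr
    _ = _ := by rw [div_eq_mul_inv]

/-- `T` majorizes every coordinate of every partial sum at once; being built from finitely many of
them, it is a measurable stand-in for the maximum over `k`. -/
theorem IsIVP.exists_quadratureError_le {Ω : Type*} [MeasurableSpace Ω] {P : Measure Ω}
    [IsProbabilityMeasure P] {τ : ℕ → Ω → ℝ} (hab : a < b) (hd : 1 ≤ d) (hn : 1 ≤ n) (hK : 0 < K)
    (hL : 0 < L) (hρ : 0 < ρ) (hρ1 : ρ ≤ 1) {m : ℕ} (hm1 : 1 ≤ m) (hm : 1 ≤ (2 * ρ - 1) * m)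
    (hτ : IsUniformSample P n τ) (hstep : (b - a) / n ≤ 1)
    (hR : ENNReal.ofReal (solutionRadius a b K) ≤ R) (h : IsIVP a b ρ K L R η f)
    (hz : IsSolution a b (η, f) z) :
    ∃ T : Ω → ℝ, AEMeasurable T P ∧
      (∀ᵐ ω ∂P, ∀ k ≤ n,
        ‖quadratureError a b n f z (node a b n fun j => τ j ω) k‖ ≤ d * T ω) ∧
      eLpNorm T ((2 * m : ℕ) : ℝ≥0∞) P ≤ ENNReal.ofReal
        (8 * d * (2 * m).factorial * (slopeConst a b K L * (b - a) ^ (ρ + 1)) / n) := by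
  have hn' : (0 : ℝ) < n := by positivity
  have hba : 0 < b - a := by linarith
  have hs := slopeConst_pos (a := a) (b := b) hK hL
  set β := slopeConst a b K L * (b - a) ^ (ρ + 1) with hβ
  have hβ0 : 0 < β := by positivity
  have hB0 : 0 < β * (n : ℝ) ^ (-(ρ + 1)) := by positivity
  have hBeq : slopeConst a b K L * ((b - a) / n) ^ ρ * ((b - a) / n) =
      β * (n : ℝ) ^ (-(ρ + 1)) := by
    rw [hβ, mul_assoc, ← Real.rpow_add_one (by positivity), Real.div_rpow hba.le hn'.le,
      Real.rpow_neg hn'.le]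
    ring
  let B : NNReal := ⟨β * (n : ℝ) ^ (-(ρ + 1)), hB0.le⟩
  let S : Fin d × Fin (n + 1) → Ω → ℝ := fun q ω =>
    ∑ j ∈ Finset.range q.2, stepError hab n f z q.1 j (τ (j + 1) ω)
  have hsub : ∀ q, HasSubgaussianMGF (S q) (((q.2 : ℕ) : NNReal) * B ^ 2) P := fun q =>
    hτ.hasSubgaussianMGF_sum (Nat.lt_succ_iff.1 q.2.2)
      (fun j => (h.continuous_stepError hab hz q.1 j).measurable)
      (fun j hj u hu => (h.abs_stepError_le hab hn hK hL hρ hρ1 hR hz hstep q.1 hj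
        (Ioo_subset_Icc_self hu)).trans_eq hBeq)
      (fun j hj => h.integral_stepError hab hn hz q.1 hj)
  refine ⟨powerMax S m, aemeasurable_powerMax fun q => (hsub q).aemeasurable, ?_, ?_⟩
  · filter_upwards [hτ.ae_mem] with ω hω k hk
    refine norm_le_card_mul fun i => ?_
    have h1 : quadratureError a b n f z (node a b n fun j => τ j ω) k i =
        S (i, ⟨k, Nat.lt_succ_iff.2 hk⟩) ω := by
      simp only [quadratureError, S, WithLp.ofLp_sum, Finset.sum_apply]
      refine Finset.sum_congr rfl fun j hj => ?_
      have hj' : j < n := (Finset.mem_range.1 hj).trans_le hk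
      rw [stepError_eq hab hn i hj' (Ioo_subset_Icc_self (hω j hj')), node_succ]
    rw [h1]
    exact abs_le_powerMax S hm1 _ ω
  · refine eLpNorm_powerMax_le hm1 (fun q => (hsub q).aemeasurable)
      (D := 4 * (2 * m).factorial * (n * (β * (n : ℝ) ^ (-(ρ + 1))) ^ 2) ^ m) ?_ (by positivity) ?_
    · intro q
      refine lintegral_pow_le_of_hasSubgaussianMGF (hsub q) (by positivity) ?_ m
      have h2 : ((q.2 : ℕ) : ℝ) ≤ n := by exact_mod_cast Nat.lt_succ_iff.1 q.2.2
      push_cast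
      change ((q.2 : ℕ) : ℝ) * (β * (n : ℝ) ^ (-(ρ + 1))) ^ 2 ≤ _
      gcongr
    · rw [Fintype.card_prod, Fintype.card_fin, Fintype.card_fin]
      exact moment_bound hd hn hβ0.le hm

end QuadratureError

/-! ### Lower bounds from linear problems -/

section LowerBounds

theorem pow_add_mul_le_pow {A B : ℝ} (hA : 1 ≤ A) (hB : 0 ≤ B) (n : ℕ) :
    A ^ n + n * B ≤ (A + B) ^ n := by
  induction n with
  | zero => simp
  | succ n ih =>
    have h1 : 1 ≤ A ^ n := one_le_pow₀ hA
    have h2 : 0 ≤ (n : ℝ) * B := by positivity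
    calc A ^ (n + 1) + (n + 1 : ℕ) * B ≤ (A ^ n + n * B) * (A + B) := by
          push_cast
          rw [pow_succ]
          nlinarith [mul_nonneg h2 hB]
      _ ≤ (A + B) ^ n * (A + B) := by gcongr
      _ = _ := (pow_succ _ _).symm

/-- With `y = x / n`, one factor `exp y` exceeds `1 + y` by at least `y ^ 2 / 2`, and the n-fold
product accumulates n such gains. -/
theorem sq_div_le_exp_sub_pow {x : ℝ} (hx : 0 ≤ x) {n : ℕ} (hn : 1 ≤ n) :
    x ^ 2 / 2 / n ≤ Real.exp x - (1 + x / n) ^ n := by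
  have hn' : (0 : ℝ) < n := by positivity
  have hy : 0 ≤ x / n := by positivity
  have h1 := Real.quadratic_le_exp_of_nonneg hy
  have h2 := pow_add_mul_le_pow (A := 1 + x / n) (B := (x / n) ^ 2 / 2) (by linarith)
    (by positivity) n
  have h3 : (1 + x / n + (x / n) ^ 2 / 2) ^ n ≤ (Real.exp (x / n)) ^ n := by gcongr
  have h4 : (Real.exp (x / n)) ^ n = Real.exp x := by
    rw [← Real.exp_nat_mul]; congr 1; field_simp
  have h5 : n * ((x / n) ^ 2 / 2) = x ^ 2 / 2 / n := by field_simp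
  linarith

/-- Over a common denominator this is the explicit difference divided by a product of at most `exp
(2 * x)`. -/
theorem sq_div_le_inv_pow_sub_exp {x : ℝ} (hx : 0 ≤ x) {n : ℕ} (hn : 1 ≤ n) :
    x ^ 2 / 2 * Real.exp (-(2 * x)) / n ≤ ((1 + x / n)⁻¹) ^ n - Real.exp (-x) := by
  have hn' : (0 : ℝ) < n := by positivity
  have h1 := sq_div_le_exp_sub_pow hx hn
  have h0 : 0 < (1 + x / n) ^ n := by positivity
  have hle : (1 + x / n) ^ n ≤ Real.exp x := by
    have : 0 ≤ x ^ 2 / 2 / n := by positivity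
    linarith
  have he := Real.exp_pos x
  have h2 : ((1 + x / n)⁻¹) ^ n - Real.exp (-x) =
      (Real.exp x - (1 + x / n) ^ n) / (Real.exp x * (1 + x / n) ^ n) := by
    rw [Real.exp_neg, inv_pow]; field_simp
  have h3 : Real.exp (-(2 * x)) = 1 / (Real.exp x * Real.exp x) := by
    rw [← Real.exp_add, Real.exp_neg, one_div]; congr 2; ring
  rw [h2, h3]
  calc x ^ 2 / 2 * (1 / (Real.exp x * Real.exp x)) / n
      = (x ^ 2 / 2 / n) / (Real.exp x * Real.exp x) := by field_simp
    _ ≤ _ := by gcongr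

variable {a b : ℝ} {d n : ℕ} {ρ K L δ l : ℝ} {η η' : Vec d}

/-- The linear right-hand side `(t, x) ↦ l x`. -/
def linearField (d : ℕ) (l : ℝ) : Field d := fun _ x => l • x

theorem isIVP_linearField (R : ℝ≥0∞) (hK : 0 ≤ K) (hL : 0 ≤ L) (hη : ‖η‖ ≤ K) (hlK : |l| ≤ K)
    (hlL : |l| ≤ L) : IsIVP a b ρ K L R η (linearField d l) where
  init_bound := hη
  cont := (continuous_snd.const_smul l).continuousOn
  growth t _ x := by
    rw [linearField, norm_smul, Real.norm_eq_abs]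
    calc |l| * ‖x‖ ≤ K * ‖x‖ := by gcongr
      _ ≤ K * (1 + ‖x‖) := by gcongr; linarith
  holder_time t _ s _ x _ := by
    simp only [linearField, sub_self, norm_zero]
    positivity
  lipschitz_space t _ x y _ _ := by
    rw [linearField, linearField, ← smul_sub, norm_smul, Real.norm_eq_abs]
    gcongr

/-- Integrating factor: `exp (-l * (t - a)) • z t` has zero derivative. The statement covers every
solution because `solution` is an unspecified choice. -/
theorem isSolution_linearField_unique {z : ℝ → Vec d} (hab : a ≤ b)
    (hz : IsSolution a b (η, linearField d l) z) : z b = Real.exp (l * (b - a)) • η := by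
  have hza : z a = η := hz.1
  have hd : ∀ t ∈ Icc a b,
      HasDerivWithinAt (fun t => Real.exp (-l * (t - a)) • z t) 0 (Icc a b) t := by
    intro t ht
    have h1 : HasDerivAt (fun t => Real.exp (-l * (t - a))) (Real.exp (-l * (t - a)) * -l) t := by
      have := (((hasDerivAt_id t).sub_const a).const_mul (-l)).exp
      simpa using this
    have h2 := h1.hasDerivWithinAt.smul (hz.2 t ht)
    refine h2.congr_deriv ?_
    simp only [linearField]
    module
  have := Convex.norm_image_sub_le_of_norm_hasDerivWithin_le hd (C := 0) (fun t _ => by simp)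
    (convex_Icc a b) (left_mem_Icc.2 hab) (right_mem_Icc.2 hab)
  rw [zero_mul, norm_le_zero_iff, sub_eq_zero, sub_self, mul_zero, Real.exp_zero, one_smul,
    hza] at this
  rw [← this, smul_smul, ← Real.exp_add]
  have e : l * (b - a) + -l * (b - a) = 0 := by ring
  rw [e, Real.exp_zero, one_smul]

theorem explicitValues_linearField (h : ℝ) (θ : ℕ → ℝ) (j : ℕ) :
    explicitValues h θ (η', linearField d l) j = (1 + l * h) ^ j • η' := by
  induction j with
  | zero => simp [explicitValues]
  | succ j ih =>
    rw [explicitValues, ih]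
    simp only [linearField]
    module

theorem implicitValues_linearField {h : ℝ} (hh : 0 < 1 + l * h) (θ : ℕ → ℝ) (j : ℕ) :
    implicitValues h θ (η', linearField d (-l)) j = ((1 + l * h)⁻¹) ^ j • η' := by
  induction j with
  | zero => simp [implicitValues]
  | succ j ih =>
    rw [implicitValues, ih]
    simp only [linearField]
    -- The choice operator is evaluated by solving the linear equation by hand; positivity of `1 + l
    -- * h` is enough, without a contraction condition.
    have huniq : ∀ x : Vec d, x = ((1 + l * h)⁻¹) ^ j • η' + h • (-l) • x →
        x = ((1 + l * h)⁻¹) ^ (j + 1) • η' := by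
      intro x hx
      have h1 : (1 + l * h) • x = ((1 + l * h)⁻¹) ^ j • η' := by
        calc (1 + l * h) • x = x - h • (-l) • x := by module
          _ = ((1 + l * h)⁻¹) ^ j • η' := by nth_rewrite 1 [hx]; abel
      rw [pow_succ', ← smul_smul, ← h1, inv_smul_smul₀ hh.ne']
    refine huniq _ (Classical.epsilon_spec (p := fun x : Vec d =>
      x = ((1 + l * h)⁻¹) ^ j • η' + h • (-l) • x) ⟨((1 + l * h)⁻¹) ^ (j + 1) • η', ?_⟩)
    have h2 : ((1 + l * h)⁻¹) ^ j = (1 + l * h) * ((1 + l * h)⁻¹) ^ (j + 1) := by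
      rw [pow_succ']; field_simp
    rw [h2]
    module

theorem zero_mem_noiseTwo (hδ : 0 ≤ δ) : (fun _ _ => 0 : Field d) ∈ noiseTwo a b d δ := by
  refine ⟨⟨measurable_const, fun t _ y => ?_⟩, fun t _ x y => ?_⟩
  · rw [norm_zero]; positivity
  · rw [sub_self, norm_zero]; positivity

theorem mem_noisyData {𝒦 : Set (Field d)} (h0 : (fun _ _ => 0 : Field d) ∈ 𝒦) {f : Field d}
    (hη : ‖η' - η‖ ≤ δ) : (η', f) ∈ noisyData 𝒦 δ (η, f) :=
  ⟨hη, _, h0, by simp⟩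

variable {Ω : Type*} [MeasurableSpace Ω] {P : Measure Ω} [IsProbabilityMeasure P] {p : ℝ}

/-- The supremum over `t` dominates the value at `b`, and a deterministic quantity is its own L^p
norm on a probability space. -/
theorem enorm_le_worstCaseError (hp : 0 < p) (hab : a ≤ b) {A : Ω → Vec d × Field d → ℝ → Vec d}
    {G : Set (Vec d × Field d)} {V : Vec d × Field d → Set (Vec d × Field d)}
    {q q' : Vec d × Field d} (hq : q ∈ G) (hq' : q' ∈ V q) {v : Vec d}
    (hv : ∀ ω, solution a b q b - A ω q' b = v) : ‖v‖ₑ ≤ worstCaseError P p a b A G V := by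
  refine le_trans ?_ (le_iSup₂_of_le (f := fun q _ => ⨆ q' ∈ V q,
    eLpNorm (fun ω => ⨆ t ∈ Icc a b, ‖solution a b q t - A ω q' t‖ₑ) (ENNReal.ofReal p) P) q hq
    (le_iSup₂_of_le (f := fun q' _ =>
      eLpNorm (fun ω => ⨆ t ∈ Icc a b, ‖solution a b q t - A ω q' t‖ₑ) (ENNReal.ofReal p) P)
      q' hq' le_rfl))
  have h1 : eLpNorm (fun _ : Ω => v) (ENNReal.ofReal p) P = ‖v‖ₑ := by
    rw [eLpNorm_const _ (by simpa using hp) (IsProbabilityMeasure.ne_zero P)]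
    simp
  rw [← h1]
  refine eLpNorm_mono_enorm fun ω => ?_
  rw [enorm_eq_self, ← hv ω]
  exact le_iSup₂_of_le (f := fun t _ => ‖solution a b q t - A ω q' t‖ₑ) b (right_mem_Icc.2 hab)
    le_rfl

theorem enorm_le_errorExplicit (τ : ℕ → Ω → ℝ) (hp : 0 < p) (hab : a < b) (hn : 1 ≤ n) (hK : 0 < K)
    (hL : 0 < L) (hδ : 0 ≤ δ) (hη : ‖η‖ ≤ K) (hη' : ‖η' - η‖ ≤ δ) (hlK : |l| ≤ K) (hlL : |l| ≤ L) :
    ‖Real.exp (l * (b - a)) • η - (1 + l * ((b - a) / n)) ^ n • η'‖ₑ ≤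
      errorExplicit P τ p a b d ρ K L n δ := by
  have hivp := isIVP_linearField (a := a) (b := b) (ρ := ρ)
    (ENNReal.ofReal (radiusZero a b K)) hK.le hL.le hη hlK hlL
  refine enorm_le_worstCaseError hp hab.le (q := (η, linearField d l))
    (q' := (η', linearField d l)) hivp (mem_noisyData (zero_mem_noiseTwo hδ).1 hη') fun ω => ?_
  rw [isSolution_linearField_unique hab.le (hivp.isSolution_solution hab hK hL
    (ENNReal.ofReal_le_ofReal (solutionRadius_le_radiusZero hab hK))), explicitEuler,
    interpolate_right hab hn, explicitValues_linearField]

theorem enorm_le_errorImplicit (τ : ℕ → Ω → ℝ) (hp : 0 < p) (hab : a < b) (hn : 1 ≤ n) (hK : 0 < K)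
    (hL : 0 < L) (hδ : 0 ≤ δ) (hη : ‖η‖ ≤ K) (hη' : ‖η' - η‖ ≤ δ) (hl : 0 ≤ l) (hlK : l ≤ K)
    (hlL : l ≤ L) :
    ‖Real.exp (-(l * (b - a))) • η - ((1 + l * ((b - a) / n))⁻¹) ^ n • η'‖ₑ ≤
      errorImplicit P τ p a b d ρ K L n δ := by
  have hivp := isIVP_linearField (a := a) (b := b) (ρ := ρ) (l := -l) ∞ hK.le hL.le hη
    (by rwa [abs_neg, abs_of_nonneg hl]) (by rwa [abs_neg, abs_of_nonneg hl])
  have hba : 0 < b - a := by linarith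
  refine enorm_le_worstCaseError hp hab.le (q := (η, linearField d (-l)))
    (q' := (η', linearField d (-l))) hivp (mem_noisyData (zero_mem_noiseTwo hδ) hη') fun ω => ?_
  rw [isSolution_linearField_unique hab.le (hivp.isSolution_solution hab hK hL le_top),
    implicitEuler, interpolate_right hab hn, implicitValues_linearField (by positivity), neg_mul]

/-- The constant of the lower error bounds. -/
def lowerConst (a b K L : ℝ) : ℝ :=
  K * ((min K L * (b - a)) ^ 2 / 2 * Real.exp (-(2 * (min K L * (b - a)))))

theorem lowerConst_pos (hab : a < b) (hK : 0 < K) (hL : 0 < L) : 0 < lowerConst a b K L := by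
  have hba : 0 < b - a := by linarith
  have : 0 < min K L := lt_min hK hL
  unfold lowerConst
  positivity

theorem ofReal_le_enorm_smul_sub {E : Type*} [NormedAddCommGroup E] [NormedSpace ℝ E] {x : E}
    {r s c : ℝ} (h : c ≤ |r - s|) : ENNReal.ofReal (‖x‖ * c) ≤ ‖r • x - s • x‖ₑ := by
  rw [← sub_smul, ← ofReal_norm, norm_smul, mul_comm, Real.norm_eq_abs]
  exact ENNReal.ofReal_le_ofReal (by gcongr)

theorem exists_vec_norm_eq (hd : 1 ≤ d) {c : ℝ} (hc : 0 ≤ c) : ∃ x : Vec d, ‖x‖ = c := by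
  have : Nonempty (Fin d) := ⟨⟨0, hd⟩⟩
  have : Nontrivial (Vec d) := (WithLp.equiv 1 (Fin d → ℝ)).nontrivial
  exact exists_norm_eq (Vec d) hc

theorem lowerConst_div_le_error (τ : ℕ → Ω → ℝ) (hp : 0 < p) (hab : a < b) (hd : 1 ≤ d)
    (hn : 1 ≤ n) (hK : 0 < K) (hL : 0 < L) (hδ : 0 ≤ δ) :
    ENNReal.ofReal (lowerConst a b K L / n) ≤ errorExplicit P τ p a b d ρ K L n δ ∧
      ENNReal.ofReal (lowerConst a b K L / n) ≤ errorImplicit P τ p a b d ρ K L n δ := by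
  obtain ⟨η, hη⟩ := exists_vec_norm_eq hd hK.le
  have hn' : (0 : ℝ) < n := by positivity
  have hba : 0 < b - a := by linarith
  set l := min K L with hl
  have hl0 : 0 < l := lt_min hK hL
  have hlK : l ≤ K := min_le_left _ _
  have hlL : l ≤ L := min_le_right _ _
  have hη' : ‖η - η‖ ≤ δ := by simpa using hδ
  have hx : 0 ≤ l * (b - a) := by positivity
  have hcn : lowerConst a b K L / n = ‖η‖ *
      ((l * (b - a)) ^ 2 / 2 * Real.exp (-(2 * (l * (b - a)))) / n) := by
    rw [lowerConst, hη]; ring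
  rw [hcn]
  constructor
  · refine le_trans (ofReal_le_enorm_smul_sub ?_) (enorm_le_errorExplicit (η := η) (η' := η) τ hp
      hab hn hK hL hδ hη.le hη' (l := l) (by rwa [abs_of_pos hl0]) (by rwa [abs_of_pos hl0]))
    rw [← mul_div_assoc]
    refine le_trans ?_ ((sq_div_le_exp_sub_pow hx hn).trans (le_abs_self _))
    gcongr
    refine mul_le_of_le_one_right (by positivity) (Real.exp_le_one_iff.2 (by linarith))
  · refine le_trans (ofReal_le_enorm_smul_sub ?_) (enorm_le_errorImplicit (η := η) (η' := η) τ hp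
      hab hn hK hL hδ hη.le hη' hl0.le hlK hlL)
    rw [← mul_div_assoc, abs_sub_comm]
    exact (sq_div_le_inv_pow_sub_exp hx hn).trans (le_abs_self _)

theorem noise_le_error (τ : ℕ → Ω → ℝ) (hp : 0 < p) (hab : a < b) (hd : 1 ≤ d)
    (hn : 1 ≤ n) (hK : 0 < K) (hL : 0 < L) (hδ : 0 ≤ δ) :
    ENNReal.ofReal δ ≤ errorExplicit P τ p a b d ρ K L n δ ∧
      ENNReal.ofReal δ ≤ errorImplicit P τ p a b d ρ K L n δ := by
  obtain ⟨η, hη⟩ := exists_vec_norm_eq hd hδ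
  have h1 : ENNReal.ofReal δ = ‖η‖ₑ := by rw [← hη, ofReal_norm]
  constructor
  · have := enorm_le_errorExplicit (P := P) (ρ := ρ) (η := 0) (η' := η) τ hp hab hn hK hL hδ
      (by simpa using hK.le) (by simpa using hη.le) (l := 0) (by simpa using hK.le)
      (by simpa using hL.le)
    simpa [h1] using this
  · have := enorm_le_errorImplicit (P := P) (ρ := ρ) (η := 0) (η' := η) τ hp hab hn hK hL hδ
      (by simpa using hK.le) (by simpa using hη.le) (l := 0) le_rfl hK.le hL.le
    simpa [h1] using this

end LowerBounds

/-! ### Upper bounds in L^p -/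

section UpperBounds

variable {a b : ℝ} {d n : ℕ} {ρ K L δ p : ℝ}

/-- The constant of the upper error bounds, in terms of a constant `C` for the quadrature error. -/
def upperConst (a b : ℝ) (d : ℕ) (K L C : ℝ) : ℝ :=
  2 * Real.exp (2 * (L * (b - a))) * (1 + (b - a) * (L * (speedBound a b K * (b - a)) +
    valueBound a b K) + d * C) + speedBound a b K * (b - a)

theorem upperConst_pos (hab : a < b) (hK : 0 < K) (hL : 0 < L) {C : ℝ} (hC : 0 ≤ C) :
    0 < upperConst a b d K L C := by
  have hba : 0 < b - a := by linarith
  have := speedBound_pos (a := a) (b := b) hK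
  unfold upperConst valueBound
  positivity

/-- `pathBound` is affine in the quadrature error, so Minkowski applies, and the exponent is raised
from `p` to `2 * m`. Monotonicity of `eLpNorm` does not require the supremum over `t` to be
measurable. -/
theorem eLpNorm_iSup_enorm_le {Ω : Type*} [MeasurableSpace Ω] {P : Measure Ω}
    [IsProbabilityMeasure P] (hab : a < b) (hn : 1 ≤ n) (hK : 0 < K) (hL : 0 < L)
    (hp : 1 ≤ p) (hδ : 0 ≤ δ) {m : ℕ} (hpm : p ≤ (2 * m : ℕ)) {D : Ω → ℝ → Vec d} {T : Ω → ℝ}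
    {C : ℝ} (hC : 0 ≤ C) (hTm : AEMeasurable T P)
    (hT : eLpNorm T ((2 * m : ℕ) : ℝ≥0∞) P ≤ ENNReal.ofReal (C / n))
    (hD : ∀ᵐ ω ∂P, ∀ t ∈ Icc a b, ‖D ω t‖ ≤ pathBound a b K L (d * T ω) ((b - a) / n) δ) :
    eLpNorm (fun ω => ⨆ t ∈ Icc a b, ‖D ω t‖ₑ) (ENNReal.ofReal p) P ≤
      ENNReal.ofReal (upperConst a b d K L C * ((n : ℝ)⁻¹ + δ)) := by
  have hn' : (0 : ℝ) < n := by positivity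
  have hba : 0 < b - a := by linarith
  have hsp := speedBound_pos (a := a) (b := b) hK
  set α := 2 * Real.exp (2 * (L * (b - a))) with hα
  have hα0 : 0 < α := by positivity
  have hW : 0 < valueBound a b K := by unfold valueBound; positivity
  set γ := α * (δ + (b - a) * (L * (speedBound a b K * ((b - a) / n)) + δ * valueBound a b K)) +
    speedBound a b K * ((b - a) / n) with hγ
  have hγ0 : 0 ≤ γ := by positivity
  have hpb : ∀ ω, pathBound a b K L (d * T ω) ((b - a) / n) δ = γ + α * d * T ω := by
    intro ω
    rw [pathBound, hγ, hα]; ring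
  have hp1 : 1 ≤ ENNReal.ofReal p := by
    rw [← ENNReal.ofReal_one]; exact ENNReal.ofReal_le_ofReal hp
  have hp0 : ENNReal.ofReal p ≠ 0 := (lt_of_lt_of_le zero_lt_one hp1).ne'
  have hTp : eLpNorm T (ENNReal.ofReal p) P ≤ ENNReal.ofReal (C / n) := by
    refine (eLpNorm_le_eLpNorm_of_exponent_le ?_ hTm.aestronglyMeasurable).trans hT
    rw [← ENNReal.ofReal_natCast]
    exact ENNReal.ofReal_le_ofReal hpm
  have h1 : eLpNorm (fun ω => ⨆ t ∈ Icc a b, ‖D ω t‖ₑ) (ENNReal.ofReal p) P ≤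
      eLpNorm ((fun _ => γ) + (α * d) • T) (ENNReal.ofReal p) P := by
    refine eLpNorm_mono_enorm_ae ?_
    filter_upwards [hD] with ω hω
    rw [enorm_eq_self]
    refine iSup₂_le fun t ht => ?_
    have h2 := hω t ht
    rw [hpb] at h2
    rw [← ofReal_norm, ← ofReal_norm]
    exact ENNReal.ofReal_le_ofReal (h2.trans (le_abs_self _))
  refine h1.trans ((eLpNorm_add_le aestronglyMeasurable_const
    (hTm.aestronglyMeasurable.const_smul _) hp1).trans ?_)
  rw [eLpNorm_const _ hp0 (IsProbabilityMeasure.ne_zero P), eLpNorm_const_smul, measure_univ,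
    ENNReal.one_rpow, mul_one, Real.enorm_of_nonneg hγ0, Real.enorm_of_nonneg (by positivity)]
  calc ENNReal.ofReal γ + ENNReal.ofReal (α * d) * eLpNorm T (ENNReal.ofReal p) P
      ≤ ENNReal.ofReal γ + ENNReal.ofReal (α * d) * ENNReal.ofReal (C / n) := by gcongr
    _ = ENNReal.ofReal (γ + α * d * (C / n)) := by
        rw [← ENNReal.ofReal_mul (by positivity), ← ENNReal.ofReal_add hγ0 (by positivity)]
    _ ≤ _ := by
        apply ENNReal.ofReal_le_ofReal
        have hN : 0 < (n : ℝ)⁻¹ := by positivity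
        have e : upperConst a b d K L C * ((n : ℝ)⁻¹ + δ) - (γ + α * d * (C / n)) =
            α * (n : ℝ)⁻¹ * (1 + (b - a) * valueBound a b K) +
            δ * (α * ((b - a) * (L * (speedBound a b K * (b - a))) + d * C) +
              speedBound a b K * (b - a)) := by
          rw [upperConst, hγ, hα, div_eq_mul_inv, div_eq_mul_inv]; ring
        have : 0 ≤ upperConst a b d K L C * ((n : ℝ)⁻¹ + δ) - (γ + α * d * (C / n)) := by
          rw [e]; positivity
        linarith

/-- The condition on `K + L + 2` collects all step-size restrictions: `h ≤ 1`, and `L * h`, `(L + 1)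
* h`, `(K + 1) * h` at most 1/2. -/
theorem error_le {Ω : Type*} [MeasurableSpace Ω] {P : Measure Ω} [IsProbabilityMeasure P]
    {τ : ℕ → Ω → ℝ} (hab : a < b) (hd : 1 ≤ d) (hn : 1 ≤ n) (hK : 0 < K) (hL : 0 < L) (hρ : 0 < ρ)
    (hρ1 : ρ ≤ 1) (hp : 1 ≤ p) {m : ℕ} (hpm : p ≤ (2 * m : ℕ)) (hm1 : 1 ≤ m)
    (hm : 1 ≤ (2 * ρ - 1) * m) (hτ : IsUniformSample P n τ) (hδ : 0 ≤ δ) (hδ1 : δ ≤ 1)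
    (hstep : (K + L + 2) * ((b - a) / n) ≤ 1 / 2) {B : ℝ}
    (hB : B = upperConst a b d K L
      (8 * d * (2 * m).factorial * (slopeConst a b K L * (b - a) ^ (ρ + 1)))) :
    errorExplicit P τ p a b d ρ K L n δ ≤ ENNReal.ofReal (B * ((n : ℝ)⁻¹ + δ)) ∧
      errorImplicit P τ p a b d ρ K L n δ ≤ ENNReal.ofReal (B * ((n : ℝ)⁻¹ + δ)) := by
  have hn' : (0 : ℝ) < n := by positivity
  have hba : 0 < b - a := by linarith
  have hh : 0 < (b - a) / n := by positivity
  have hK' : 0 < K * ((b - a) / n) := by positivity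
  have hL' : 0 < L * ((b - a) / n) := by positivity
  have hsl := slopeConst_pos (a := a) (b := b) hK hL
  have hmem : ∀ᵐ ω ∂P, ∀ j < n, τ (j + 1) ω ∈ Icc (0 : ℝ) 1 := by
    filter_upwards [hτ.ae_mem] with ω hω j hj
    exact Ioo_subset_Icc_self (hω j hj)
  subst hB
  constructor
  · refine iSup₂_le fun q hq => iSup₂_le fun q' hq' => ?_
    obtain ⟨η, f⟩ := q
    obtain ⟨η', f'⟩ := q'
    obtain ⟨hη, g, hg, rfl⟩ := hq'
    have hR := ENNReal.ofReal_le_ofReal (solutionRadius_le_radiusZero hab hK)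
    have hz := IsIVP.isSolution_solution hab hK hL hR hq
    obtain ⟨T, hTm, hTb, hT⟩ := IsIVP.exists_quadratureError_le hab hd hn hK hL hρ hρ1 hm1 hm hτ
      (by linarith) hR hq hz
    refine eLpNorm_iSup_enorm_le hab hn hK hL hp hδ hpm (by positivity) hTm hT ?_
    filter_upwards [hTb, hmem] with ω hω hω' t ht
    exact IsIVP.norm_solution_sub_explicitEuler_le hab hn hK hL hq hz hδ hδ1 (by linarith) hg.2 hη
      hω' hω ht
  · refine iSup₂_le fun q hq => iSup₂_le fun q' hq' => ?_
    obtain ⟨η, f⟩ := q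
    obtain ⟨η', f'⟩ := q'
    obtain ⟨hη, g, hg, rfl⟩ := hq'
    have hz := IsIVP.isSolution_solution hab hK hL le_top hq
    obtain ⟨T, hTm, hTb, hT⟩ := IsIVP.exists_quadratureError_le hab hd hn hK hL hρ hρ1 hm1 hm hτ
      (by linarith) le_top hq hz
    refine eLpNorm_iSup_enorm_le hab hn hK hL hp hδ hpm (by positivity) hTm hT ?_
    filter_upwards [hTb, hmem] with ω hω hω' t ht
    exact IsIVP.norm_solution_sub_implicitEuler_le hab hn hK hL hq hz hδ hδ1 (by linarith)
      (by linarith) hg.1.2 hg.2 hη hω' hω ht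

end UpperBounds

/-! ### Comparison of rates and the main theorem -/

theorem exists_mul_rpow_lt_div {c s : ℝ} (hc : 0 < c) (hs : 1 < s) (M : ℝ) :
    ∃ N : ℕ, 1 ≤ N ∧ ∀ n : ℕ, N ≤ n → M * (n : ℝ) ^ (-s) < c / n := by
  have ht := ((tendsto_rpow_atTop (sub_pos.2 hs)).comp tendsto_natCast_atTop_atTop).eventually_gt_atTop
    (M / c)
  obtain ⟨N, hN⟩ := Filter.eventually_atTop.1 ht
  refine ⟨max N 1, le_max_right _ _, fun n hn => ?_⟩
  have hn' : (0 : ℝ) < n := by exact_mod_cast lt_of_lt_of_le zero_lt_one ((le_max_right N 1).trans hn)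
  have h1 := hN n ((le_max_left _ _).trans hn)
  simp only [Function.comp] at h1
  rw [div_lt_iff₀ hc] at h1
  have h2 : c / n = ((n : ℝ) ^ (s - 1) * c) * (n : ℝ) ^ (-s) := by
    rw [mul_right_comm, ← Real.rpow_add hn']
    have : s - 1 + -s = -1 := by ring
    rw [this, Real.rpow_neg_one]; ring
  rw [h2]
  gcongr

theorem ofReal_le_of_le_of_le {c c₀ r δ : ℝ} {e : ℝ≥0∞} (hr : 0 ≤ r) (hδ : 0 ≤ δ)
    (hc : c ≤ c₀ / 2) (hc1 : c ≤ 1 / 2) (h1 : ENNReal.ofReal (c₀ * r) ≤ e)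
    (h2 : ENNReal.ofReal δ ≤ e) : ENNReal.ofReal (c * (r + δ)) ≤ e := by
  have h3 : c * (r + δ) ≤ max (c₀ * r) δ := by
    have h4 := mul_le_mul_of_nonneg_right hc hr
    have h5 := mul_le_mul_of_nonneg_right hc1 hδ
    have h6 := le_max_left (c₀ * r) δ
    have h7 := le_max_right (c₀ * r) δ
    linarith
  refine (ENNReal.ofReal_le_ofReal h3).trans ?_
  rw [ENNReal.ofReal_max]
  exact max_le h1 h2

end RandEuler

end

theorem proposition5p2 (a b : ℝ) (hab : a < b) (d : ℕ) (hd : 1 ≤ d) (ρ K L p : ℝ)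
    (hρ : 1 / 2 < ρ) (hρ1 : ρ ≤ 1) (hK : 0 < K) (hL : 0 < L) (hp : 2 ≤ p) :
    (∃ c C δ₀ : ℝ, ∃ n₀ : ℕ, 0 < c ∧ 0 < C ∧ 0 < δ₀ ∧ δ₀ ≤ 1 ∧ 1 ≤ n₀ ∧
      ∀ (Ω : Type*) [MeasurableSpace Ω] (P : Measure Ω) [IsProbabilityMeasure P]
        (τ : ℕ → Ω → ℝ) (n : ℕ), n₀ ≤ n → RandEuler.IsUniformSample P n τ →
      ∀ δ : ℝ, 0 ≤ δ → δ ≤ δ₀ →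
        (ENNReal.ofReal (c * ((n : ℝ)⁻¹ + δ)) ≤
            RandEuler.errorExplicit P τ p a b d ρ K L n δ ∧
          RandEuler.errorExplicit P τ p a b d ρ K L n δ ≤
            ENNReal.ofReal (C * ((n : ℝ)⁻¹ + δ))) ∧
        (ENNReal.ofReal (c * ((n : ℝ)⁻¹ + δ)) ≤
            RandEuler.errorImplicit P τ p a b d ρ K L n δ ∧
          RandEuler.errorImplicit P τ p a b d ρ K L n δ ≤
            ENNReal.ofReal (C * ((n : ℝ)⁻¹ + δ)))) ∧
    (∀ M : ℝ, ∃ N : ℕ,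
      ∀ (Ω : Type*) [MeasurableSpace Ω] (P : Measure Ω) [IsProbabilityMeasure P]
        (τ : ℕ → Ω → ℝ) (n : ℕ), N ≤ n → RandEuler.IsUniformSample P n τ →
        ENNReal.ofReal (M * (n : ℝ) ^ (-(ρ + 1 / 2))) <
            RandEuler.errorExplicit P τ p a b d ρ K L n 0 ∧
          ENNReal.ofReal (M * (n : ℝ) ^ (-(ρ + 1 / 2))) <
            RandEuler.errorImplicit P τ p a b d ρ K L n 0) 
    := by
  have hba : 0 < b - a := by linarith
  have hc := RandEuler.lowerConst_pos hab hK hL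
  refine ⟨?_, fun M => ?_⟩
  -- The moment order `2 * m` must be at least `p`, and `m` large enough that `(2 * ρ - 1) * m ≥ 1`;
  -- the latter is possible because ρ > 1/2.
  · obtain ⟨m, hm⟩ := exists_nat_ge (max (max p 1) (1 / (2 * ρ - 1)))
    have hmp : p ≤ m := ((le_max_left _ _).trans (le_max_left _ _)).trans hm
    have hm1 : (1 : ℝ) ≤ m := ((le_max_right _ _).trans (le_max_left _ _)).trans hm
    have hmρ : 1 ≤ (2 * ρ - 1) * m := by
      have h := (le_max_right _ _).trans hm
      rwa [div_le_iff₀' (by linarith)] at h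
    have hpm : p ≤ (2 * m : ℕ) := by push_cast; linarith
    obtain ⟨N, hN⟩ := exists_nat_ge (2 * ((K + L + 2) * (b - a)))
    have hsl := RandEuler.slopeConst_pos (a := a) (b := b) hK hL
    refine ⟨min (RandEuler.lowerConst a b K L / 2) (1 / 2), RandEuler.upperConst a b d K L
      (8 * d * (2 * m).factorial * (RandEuler.slopeConst a b K L * (b - a) ^ (ρ + 1))), 1,
      max N 1, by positivity, RandEuler.upperConst_pos hab hK hL (by positivity), one_pos, le_rfl,
      le_max_right _ _, ?_⟩
    intro Ω _ P _ τ n hn hτ δ hδ hδ1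
    have hn1 : 1 ≤ n := (le_max_right _ _).trans hn
    have hn' : (0 : ℝ) < n := by positivity
    have hstep : (K + L + 2) * ((b - a) / n) ≤ 1 / 2 := by
      have h1 : (N : ℝ) ≤ n := by exact_mod_cast (le_max_left _ _).trans hn
      rw [← mul_div_assoc, div_le_iff₀ hn']
      linarith
    have hup := RandEuler.error_le hab hd hn1 hK hL (by linarith) hρ1 (by linarith) hpm
      (by exact_mod_cast hm1) hmρ hτ hδ hδ1 hstep rfl
    have hlow := RandEuler.lowerConst_div_le_error (P := P) (p := p) (ρ := ρ) τ (by linarith) hab hd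
      hn1 hK hL hδ
    have hnoise := RandEuler.noise_le_error (P := P) (p := p) (ρ := ρ) τ (by linarith) hab hd
      hn1 hK hL hδ
    rw [div_eq_mul_inv] at hlow
    exact ⟨⟨RandEuler.ofReal_le_of_le_of_le (by positivity) hδ (min_le_left _ _) (min_le_right _ _)
        hlow.1 hnoise.1, hup.1⟩,
      ⟨RandEuler.ofReal_le_of_le_of_le (by positivity) hδ (min_le_left _ _) (min_le_right _ _)
        hlow.2 hnoise.2, hup.2⟩⟩
  · obtain ⟨N, hN1, hN⟩ := RandEuler.exists_mul_rpow_lt_div hc (by linarith : 1 < ρ + 1 / 2) M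
    refine ⟨N, fun Ω _ P _ τ n hn _ => ?_⟩
    have hn1 : 1 ≤ n := hN1.trans hn
    have hlow := RandEuler.lowerConst_div_le_error (P := P) (p := p) (ρ := ρ) τ (by linarith) hab hd
      hn1 hK hL le_rfl
    have hlt : ENNReal.ofReal (M * (n : ℝ) ^ (-(ρ + 1 / 2))) <
        ENNReal.ofReal (RandEuler.lowerConst a b K L / n) :=
      (ENNReal.ofReal_lt_ofReal_iff (by positivity)).2 (hN n hn)
    exact ⟨hlt.trans_le hlow.1, hlt.trans_le hlow.2⟩
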